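/- A closed system of rays is a nonempty family of closed rays in $\mathbb C$ issuing from $0$ whose union $S$ is a closed subset of $\mathbb C$; the connected components of $\mathbb C\setminus S$ are open angles $\angle(\alpha,\beta)=\{re^{i\theta}: r>0,\ \alpha<\theta<\beta\}$ with $\alpha<\beta\le\alpha+2\pi$, called the angles complementary to $S$. For $z\in\mathbb C$ and a Borel set $B\subset\mathbb C$ let $\omega(z,B;\mathbb C\setminus S)$ be the harmonic measure of $B\cap\partial\angle(\alpha,\beta)$ at $z$ for the domain $\angle(\alpha,\beta)$ if $z$ lies in the complementary angle $\angle(\alpha,\beta)$, and $\delta_z(B)$ if $z\in S$. Write $D(r)=\{|z|<r\}$. For $p\ge 0$, a positive Borel measure $\mu$ on $\mathbb C$, finite on compact sets, has finite type at order $p$ if $$\limsup_{r\to+\infty}\frac{\mu(\overline{D}(r))}{r^p}<+\infty .$$ A positive Borel measure $\nu$ on $\mathbb C$, finite on compact sets, satisfies the Blaschke condition (near infinity) in $\angle(\alpha,\beta)$ if for some $r_0>0$ $$\int_{\angle(\alpha,\beta)\setminus D(r_0)}-\operatorname{Im}\frac{1}{(ze^{-i\alpha})^{\pi/(\beta-\alpha)}}\,d\nu(z)<+\infty,$$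 where $(re^{i\theta})^{\kappa}=r^{\kappa}e^{i\kappa\theta}$ for $0<\theta<2\pi$; it satisfies the Blaschke condition outside $S$ if it does so in every angle complementary to $S$. The balayage $\nu_S^{\rm bal}$ of $\nu$ onto $S$ exists if there is a Borel measure $\nu_S^{\rm bal}$, finite on compact sets, with $\nu_S^{\rm bal}(B)=\int_{\mathbb C}\omega(z,B;\mathbb C\setminus S)\,d\nu(z)$ for all Borel $B\subset\mathbb C$. Theorem. Let $S$ be a closed system of rays, $p\ge0$, and let $\nu$ be a positive Borel measure on $\mathbb C$, finite on compact sets, of finite type at order $p$. Then there are at most $2p$ angles complementary to $S$ of opening $\beta-\alpha\ge\pi/p$ (none if $p=0$), and the following four statements are equivalent: (i) $\int_{\mathbb C}\omega(z,D(r_0);\mathbb C\setminus S)\,d\nu(z)<+\infty$ for some $r_0>0$; (ii) $\nu$ satisfies the Blaschke condition in each angle $\angle(\alpha,\beta)$ complementary to $S$ of opening $\beta-\alpha\ge\pi/p$; (iii) $\nu$ satisfies the Blaschke condition outside $S$; (iv) the balayage $\nu_S^{\rm bal}$ exists and has finite type at order $p$. -/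

import Mathlib

open MeasureTheory Filter Topology

noncomputable section

namespace Balayage

/-! ### Systems of rays and their complementary angles -/

/-- The closed ray from the origin in the direction `u`. -/
def ray (u : Circle) : Set ℂ := {z | ∃ t : ℝ, 0 ≤ t ∧ z = (t : ℂ) * (u : ℂ)}

/-- `S` is (the point set of) a nonempty closed system of rays issuing from the origin. -/
def IsClosedRaySystem (S : Set ℂ) : Prop :=
  IsClosed S ∧ ∃ Θ : Set Circle, Θ.Nonempty ∧ S = ⋃ u ∈ Θ, ray u

/-- The open angle `∠(α, β)` with vertex at the origin. -/
def openAngle (α β : ℝ) : Set ℂ :=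
  {z | ∃ r θ : ℝ, 0 < r ∧ α < θ ∧ θ < β ∧ z = (r : ℂ) * Complex.exp ((θ : ℂ) * Complex.I)}

/-- `∠(α, β)`, with `α < β ≤ α + 2π`, is an angle complementary to `S`, that is, a connected
component of the complement of `S`. -/
def IsComplementaryAngle (S : Set ℂ) (α β : ℝ) : Prop :=
  α < β ∧ β ≤ α + 2 * Real.pi ∧ ∃ z ∈ Sᶜ, openAngle α β = connectedComponentIn Sᶜ z

/-! ### Harmonic measure through Perron functions

The boundary of a plane set is taken in the Riemann sphere `OnePoint ℂ`. -/

instance instMeasurableSpaceSphere : MeasurableSpace (OnePoint ℂ) := borel (OnePoint ℂ)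

instance instBorelSpaceSphere : BorelSpace (OnePoint ℂ) := ⟨rfl⟩

/-- The boundary in the Riemann sphere of a plane set `D`. -/
def sphereBoundary (D : Set ℂ) : Set (OnePoint ℂ) :=
  frontier ((fun z : ℂ => (z : OnePoint ℂ)) '' D)

/-- `u` is subharmonic on the open set `D`: it is upper semicontinuous with values in `[-∞, ∞)`
and satisfies the local submean inequality. The mean of the upper semicontinuous function `u`
over a circle, which may be `-∞`, is the infimum of the means of its continuous real majorants
on that circle. -/
def IsSubharmonicOn (u : ℂ → EReal) (D : Set ℂ) : Prop :=
  UpperSemicontinuousOn u D ∧ (∀ z ∈ D, u z < ⊤) ∧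
    ∀ z ∈ D, ∃ ρ : ℝ, 0 < ρ ∧ Metric.ball z ρ ⊆ D ∧ ∀ r : ℝ, 0 < r → r < ρ →
      ∀ φ : ℂ → ℝ, ContinuousOn φ (Metric.sphere z r) →
        (∀ w ∈ Metric.sphere z r, u w ≤ (φ w : EReal)) →
          u z ≤ ((Real.circleAverage φ z r : ℝ) : EReal)

/-- `limsup u(z') ≤ f(ζ)` as `z' → ζ` in `D`, for every boundary point `ζ` of `D`. -/
def BoundaryLE (D : Set ℂ) (u : ℂ → EReal) (f : OnePoint ℂ → ℝ) : Prop :=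
  ∀ ζ ∈ sphereBoundary D,
    limsup u (comap (fun z : ℂ => (z : OnePoint ℂ)) (𝓝 ζ) ⊓ 𝓟 D) ≤ (f ζ : EReal)

/-- The Perron function of the boundary data `f` on `D`. -/
def perron (D : Set ℂ) (f : OnePoint ℂ → ℝ) (z : ℂ) : EReal :=
  sSup {y | ∃ u : ℂ → EReal, IsSubharmonicOn u D ∧ BoundaryLE D u f ∧ y = u z}

/-- `μ` is the harmonic measure of `D` at `z`: a finite Borel measure on the boundary of `D`
against which every continuous function on the boundary integrates to its Perron function. -/
def IsHarmonicMeasure (D : Set ℂ) (z : ℂ) (μ : Measure (OnePoint ℂ)) : Prop :=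
  IsFiniteMeasure μ ∧ μ (sphereBoundary D)ᶜ = 0 ∧
    ∀ f : OnePoint ℂ → ℝ, ContinuousOn f (sphereBoundary D) →
      ((∫ w in sphereBoundary D, f w ∂μ : ℝ) : EReal) = perron D f z

open Classical in
/-- The harmonic measure `ω_D(z, ·)`; the value `0` is used only if there is none. -/
def harmonicMeasure (D : Set ℂ) (z : ℂ) : Measure (OnePoint ℂ) :=
  if h : ∃ μ : Measure (OnePoint ℂ), IsHarmonicMeasure D z μ then h.choose else 0

open Classical in
/-- The harmonic measure `ω(z, B; ℂ ∖ S)` for the complement of a system of rays: the Dirac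
measure at the points of `S`, and the harmonic measure of the complementary angle containing `z`
at the other points. -/
def omega (S : Set ℂ) (z : ℂ) (B : Set ℂ) : ENNReal :=
  if z ∈ S then Measure.dirac z B
  else harmonicMeasure (connectedComponentIn Sᶜ z) z ((fun w : ℂ => (w : OnePoint ℂ)) '' B)

/-! ### Growth, the Blaschke condition, balayage -/

/-- The type of the positive measure `ν` at order `p` near infinity. -/
def typeAtInfty (p : ℝ) (ν : Measure ℂ) : ENNReal :=
  limsup (fun r : ℝ => ν (Metric.closedBall 0 r) / ENNReal.ofReal (r ^ p)) atTop

/-- The map `z ↦ (z e^{-iα})^{π/(β-α)}` of `∠(α, β)` onto the upper half-plane. On this angle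
`w = z e^{-iα}` has an argument in `(0, 2π)`, and `log (-w) + iπ` is the logarithm of `w` whose
imaginary part is that argument. -/
def angleReduction (α β : ℝ) (z : ℂ) : ℂ :=
  Complex.exp (((Real.pi / (β - α) : ℝ) : ℂ) *
    (Complex.log (-(z * Complex.exp (-(α : ℂ) * Complex.I))) + (Real.pi : ℂ) * Complex.I))

/-- The Blaschke condition near infinity in the angle `∠(α, β)`. -/
def BlaschkeInAngle (ν : Measure ℂ) (α β : ℝ) : Prop :=
  ∃ r₀ : ℝ, 0 < r₀ ∧
    ∫⁻ z in openAngle α β \ Metric.ball 0 r₀,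
      ENNReal.ofReal (-(1 / angleReduction α β z).im) ∂ν < ⊤

/-- The Blaschke condition near infinity outside the system of rays `S`. -/
def BlaschkeOutside (ν : Measure ℂ) (S : Set ℂ) : Prop :=
  ∀ α β : ℝ, IsComplementaryAngle S α β → BlaschkeInAngle ν α β

/-- `μ` is the balayage of `ν` onto the system of rays `S`: a Borel measure, finite on compact
sets, given by integration of the harmonic measure for the complement of `S`. -/
def IsBalayage (S : Set ℂ) (ν μ : Measure ℂ) : Prop :=
  IsFiniteMeasureOnCompacts μ ∧
    ∀ B : Set ℂ, MeasurableSet B → μ B = ∫⁻ z, omega S z B ∂ν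

end Balayage

end

/-!
The power `z ↦ (z e^{-iα})^κ`, `κ = π / (β - α)`, maps `∠(α, β)` onto the upper half-plane, so
the harmonic measure of the angle is the Poisson kernel of the half-plane transported by it. For
`|z|` large the harmonic measure at `z` of a disc of radius `r` about the vertex is therefore
`r ^ κ` times the Blaschke kernel `-Im (z e^{-iα})^{-κ}`, up to constants; this kernel is at most
`|z| ^ {-κ}`. In an angle with `κ ≤ p` the Blaschke condition thus bounds the swept mass in the
disc by `O(r ^ κ)`. Where `κ > p`, the finite type of `ν` alone makes the swept mass `O(r ^ p)`,
uniformly in the angle: only finitely many complementary angles have exponent at most `p + 1`, so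
the exponents above `p` stay above some `q > p`.
-/

noncomputable section

namespace Balayage

open Set Metric
open Complex (I)
open scoped Real ENNReal

/-! ### The Dirichlet problem on a plane domain -/

/-- The filter of neighbourhoods in `D` of a point of the Riemann sphere. -/
abbrev nhdsIn (D : Set ℂ) (ζ : OnePoint ℂ) : Filter ℂ :=
  comap (fun z : ℂ => (z : OnePoint ℂ)) (𝓝 ζ) ⊓ 𝓟 D

theorem nhdsIn_coe (D : Set ℂ) (c : ℂ) : nhdsIn D c = 𝓝[D] c := by
  rw [nhdsIn, ← OnePoint.isOpenEmbedding_coe.isInducing.nhds_eq_comap, nhdsWithin]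

theorem nhdsIn_infty (D : Set ℂ) : nhdsIn D OnePoint.infty = cocompact ℂ ⊓ 𝓟 D := by
  rw [nhdsIn, OnePoint.comap_coe_nhds_infty, coclosedCompact_eq_cocompact]

/-- `F` is continuous on `D` and has the mean value property on the closed discs contained
in `D`. -/
structure HasMeanValueOn (F : ℂ → ℝ) (D : Set ℂ) : Prop where
  continuousOn : ContinuousOn F D
  circleAverage_eq : ∀ z r, 0 < r → closedBall z r ⊆ D → Real.circleAverage F z r = F z

section Dirichlet

variable {D : Set ℂ} {u : ℂ → EReal} {F : ℂ → ℝ} {f : OnePoint ℂ → ℝ}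

theorem HasMeanValueOn.isSubharmonicOn (hF : HasMeanValueOn F D) (hD : IsOpen D) :
    IsSubharmonicOn (fun z => (F z : EReal)) D := by
  refine ⟨(continuous_coe_real_ereal.comp_continuousOn hF.continuousOn).upperSemicontinuousOn,
    fun z _ => EReal.coe_lt_top _, fun z hz => ?_⟩
  obtain ⟨ρ, hρ, hρD⟩ := Metric.isOpen_iff.1 hD z hz
  refine ⟨ρ, hρ, hρD, fun r hr hrρ φ hφ hle => EReal.coe_le_coe_iff.2 ?_⟩
  have hball : closedBall z r ⊆ D := (closedBall_subset_ball hrρ).trans hρD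
  rw [← hF.circleAverage_eq z r hr hball]
  refine Real.circleAverage_mono
    ((hF.continuousOn.mono (sphere_subset_closedBall.trans hball)).circleIntegrable hr.le)
    (hφ.circleIntegrable hr.le) fun w hw => ?_
  rw [abs_of_pos hr] at hw
  exact EReal.coe_le_coe_iff.1 (hle w hw)

theorem IsSubharmonicOn.sub_hasMeanValueOn (hu : IsSubharmonicOn u D)
    (hF : HasMeanValueOn F D) : IsSubharmonicOn (fun z => u z - F z) D := by
  obtain ⟨husc, htop, hmean⟩ := hu
  refine ⟨?_, fun z hz => ?_, fun z hz => ?_⟩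
  · have hnegF : UpperSemicontinuousOn (fun z => -(F z : EReal)) D :=
      (continuous_neg.comp continuous_coe_real_ereal).comp_continuousOn hF.continuousOn
        |>.upperSemicontinuousOn
    exact husc.add' hnegF fun z _ => EReal.continuousAt_add (.inr (by simp)) (.inr (by simp))
  · exact EReal.add_lt_top (htop z hz).ne (by simp)
  · obtain ⟨ρ, hρ, hρD, hsub⟩ := hmean z hz
    refine ⟨ρ, hρ, hρD, fun r hr hrρ φ hφ hle => ?_⟩
    have hball : closedBall z r ⊆ D := (closedBall_subset_ball hrρ).trans hρD
    have hFs : ContinuousOn F (sphere z r) :=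
      hF.continuousOn.mono (sphere_subset_closedBall.trans hball)
    have hmaj := hsub r hr hrρ (φ + F) (hφ.add hFs) fun w hw => by
      have := EReal.sub_le_iff_le_add (.inl (EReal.coe_ne_bot _)) (.inl (EReal.coe_ne_top _))
        |>.1 (hle w hw)
      exact_mod_cast this
    rw [Real.circleAverage_add (hφ.circleIntegrable hr.le) (hFs.circleIntegrable hr.le),
      hF.circleAverage_eq z r hr hball, EReal.coe_add] at hmaj
    exact EReal.sub_le_iff_le_add (.inl (EReal.coe_ne_bot _)) (.inl (EReal.coe_ne_top _)) |>.2 hmaj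

theorem exists_continuous_majorant_lt {X : Type*} [PseudoMetricSpace X] {s : Set X}
    {u : X → EReal} (hu : UpperSemicontinuousOn u s) {M : ℝ} (hM : ∀ x ∈ s, u x ≤ M)
    {x₀ : X} (hx₀ : x₀ ∈ s) (hlt : u x₀ < M) :
    ∃ φ : X → ℝ, Continuous φ ∧ (∀ x ∈ s, u x ≤ φ x) ∧ (∀ x, φ x ≤ M) ∧ φ x₀ < M := by
  obtain ⟨a, ha, haM⟩ := EReal.lt_iff_exists_real_btwn.1 hlt
  have haM : a < M := by exact_mod_cast haM
  obtain ⟨η, hη, hball⟩ := mem_nhdsWithin_iff.1 (hu x₀ hx₀ a ha)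
  refine ⟨fun x => min M (a + (M - a) * (dist x x₀ / η)), by fun_prop, fun x hx => ?_,
    fun x => min_le_left _ _, by simpa using haM⟩
  by_cases hxη : dist x x₀ < η
  · refine (show u x < a from hball ⟨hxη, hx⟩).le.trans (EReal.coe_le_coe_iff.2 ?_)
    have : 0 ≤ (M - a) * (dist x x₀ / η) := by have := sub_pos.2 haM; positivity
    exact le_min haM.le (by linarith)
  · refine (hM x hx).trans (EReal.coe_le_coe_iff.2 (le_min le_rfl ?_))
    have : 1 ≤ dist x x₀ / η := (one_le_div hη).2 (not_lt.1 hxη)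
    nlinarith

theorem circleAverage_lt_of_continuousOn {c : ℂ} {R M : ℝ}
    (hF : ContinuousOn F (sphere c |R|)) (hle : ∀ w ∈ sphere c |R|, F w ≤ M)
    (hlt : ∃ w ∈ sphere c |R|, F w < M) : Real.circleAverage F c R < M := by
  obtain ⟨w, hw, hwM⟩ := hlt
  rw [← image_circleMap_Ioc] at hw
  obtain ⟨θ, hθ, rfl⟩ := hw
  have hcont : Continuous fun t => F (circleMap c R t) :=
    hF.comp_continuous (continuous_circleMap c R) (circleMap_mem_sphere' c R)
  have hint : ∫ t in 0..2 * π, F (circleMap c R t) < ∫ _ in 0..2 * π, M :=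
    intervalIntegral.integral_lt_integral_of_continuousOn_of_le_of_exists_lt Real.two_pi_pos
      hcont.continuousOn continuousOn_const (fun t _ => hle _ (circleMap_mem_sphere' c R t))
      ⟨θ, Ioc_subset_Icc_self hθ, hwM⟩
  rw [intervalIntegral.integral_const, sub_zero, smul_eq_mul] at hint
  rw [Real.circleAverage, smul_eq_mul, inv_mul_lt_iff₀ Real.two_pi_pos]
  exact hint

theorem isCompact_superlevel {A : ℝ} (hu : UpperSemicontinuousOn u D)
    (hb : BoundaryLE D u fun _ => A) {c : EReal} (hc : A < c) :
    IsCompact {z ∈ D | c ≤ u z} := by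
  refine isCompact_iff_ultrafilter_le_nhds.2 fun 𝒰 h𝒰 => ?_
  have hmem : ∀ᶠ z in (𝒰 : Filter ℂ), z ∈ D ∧ c ≤ u z := le_principal_iff.1 h𝒰
  have hle_D : (𝒰 : Filter ℂ) ≤ 𝓟 D := le_principal_iff.2 (hmem.mono fun z h => h.1)
  have not_eventually_lt : ¬∀ᶠ z in (𝒰 : Filter ℂ), u z < c := fun h =>
    let ⟨_, hlt, _, hle⟩ := (h.and hmem).exists
    hle.not_gt hlt
  obtain ⟨ζ, -, hζ⟩ := isCompact_iff_ultrafilter_le_nhds.1 (isCompact_univ (X := OnePoint ℂ))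
    (𝒰.map fun z : ℂ => (z : OnePoint ℂ)) (by simp)
  have h𝒰ζ : (𝒰 : Filter ℂ) ≤ nhdsIn D ζ := le_inf (map_le_iff_le_comap.1 hζ) hle_D
  by_cases hζD : ζ ∈ (fun z : ℂ => (z : OnePoint ℂ)) '' D
  · obtain ⟨x, hx, rfl⟩ := hζD
    rw [nhdsIn_coe] at h𝒰ζ
    refine ⟨x, ⟨hx, ?_⟩, h𝒰ζ.trans inf_le_left⟩
    by_contra! hlt
    exact not_eventually_lt (h𝒰ζ (hu x hx c hlt))
  · have hcl : ζ ∈ closure ((fun z : ℂ => (z : OnePoint ℂ)) '' D) :=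
      mem_closure_iff_ultrafilter.2
        ⟨_, mem_map.2 (hmem.mono fun z h => mem_image_of_mem _ h.1), hζ⟩
    have hζb : ζ ∈ sphereBoundary D := ⟨hcl, fun h => hζD (interior_subset h)⟩
    exact absurd (h𝒰ζ (eventually_lt_of_limsup_lt ((hb ζ hζb).trans_lt hc))) not_eventually_lt

theorem exists_rightmost_max {A : ℝ} (hu : UpperSemicontinuousOn u D)
    (hb : BoundaryLE D u fun _ => A) {z : ℂ} (hz : z ∈ D) (hAz : A < u z) :
    ∃ x ∈ D, A < u x ∧ (∀ w ∈ D, u w ≤ u x) ∧ ∀ w ∈ D, u w = u x → w.re ≤ x.re := by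
  obtain ⟨m, ⟨hmD, hzm⟩, hmax⟩ := UpperSemicontinuousOn.exists_isMaxOn
    (s := {w ∈ D | u z ≤ u w}) ⟨z, hz, le_rfl⟩ (isCompact_superlevel hu hb hAz)
    (hu.mono fun w h => h.1)
  have hle : ∀ w ∈ D, u w ≤ u m := fun w hw =>
    (le_total (u z) (u w)).elim (fun h => hmax ⟨hw, h⟩) fun h => h.trans hzm
  obtain ⟨x, ⟨hxD, hmx⟩, hxmax⟩ :=
    (isCompact_superlevel hu hb (hAz.trans_le hzm)).exists_isMaxOn ⟨m, hmD, le_rfl⟩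
      Complex.continuous_re.continuousOn
  have hxm : u x = u m := (hle x hxD).antisymm hmx
  refine ⟨x, hxD, hxm ▸ hAz.trans_le hzm, hxm ▸ hle, fun w hw hwx => ?_⟩
  exact hxmax ⟨hw, (hwx.trans hxm).ge⟩

theorem IsSubharmonicOn.le_of_boundaryLE_const {A : ℝ} (hu : IsSubharmonicOn u D)
    (hb : BoundaryLE D u fun _ => A) {z : ℂ} (hz : z ∈ D) : u z ≤ A := by
  by_contra! hlt
  obtain ⟨husc, htop, hmean⟩ := hu
  obtain ⟨x, hx, hAx, hmax, hright⟩ := exists_rightmost_max husc hb hz hlt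
  lift u x to ℝ using ⟨(htop x hx).ne, (bot_le.trans_lt hAx).ne'⟩ with M hM
  obtain ⟨ρ, hρ, hρD, hsub⟩ := hmean x hx
  have hr : 0 < ρ / 2 := half_pos hρ
  have hsphere : sphere x (ρ / 2) ⊆ D :=
    (sphere_subset_ball (half_lt_self hρ)).trans hρD
  have hx₀ : x + (ρ / 2 : ℝ) ∈ sphere x (ρ / 2) := by simp [abs_of_pos hρ]
  have hx₀M : u (x + (ρ / 2 : ℝ)) < M := by
    refine (hmax _ (hsphere hx₀)).lt_of_ne fun h => ?_
    have := hright _ (hsphere hx₀) h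
    rw [Complex.add_re, Complex.ofReal_re] at this
    linarith
  obtain ⟨φ, hφ, huφ, hφM, hφlt⟩ := exists_continuous_majorant_lt (husc.mono hsphere)
    (fun w hw => hmax w (hsphere hw)) hx₀ hx₀M
  have havg : M ≤ Real.circleAverage φ x (ρ / 2) := EReal.coe_le_coe_iff.1 <|
    hM.le.trans (hsub (ρ / 2) hr (half_lt_self hρ) φ hφ.continuousOn huφ)
  refine havg.not_gt (circleAverage_lt_of_continuousOn hφ.continuousOn (fun w _ => hφM w) ?_)
  exact ⟨_, by rwa [abs_of_pos hr], hφlt⟩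

theorem BoundaryLE.sub_of_tendsto (hu : BoundaryLE D u f)
    (hF : ∀ ζ ∈ sphereBoundary D, Tendsto F (nhdsIn D ζ) (𝓝 (f ζ))) :
    BoundaryLE D (fun z => u z - F z) fun _ => 0 := by
  intro ζ hζ
  change limsup _ (nhdsIn D ζ) ≤ _
  rcases (nhdsIn D ζ).eq_or_neBot with hbot | _
  · simp [hbot]
  have hlim : limsup (fun z => -(F z : EReal)) (nhdsIn D ζ) = -(f ζ : EReal) :=
    ((continuous_neg.comp continuous_coe_real_ereal).tendsto (f ζ)
      |>.comp (hF ζ hζ)).limsup_eq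
  calc limsup (fun z => u z - F z) (nhdsIn D ζ)
      ≤ limsup u (nhdsIn D ζ) + limsup (fun z => -(F z : EReal)) (nhdsIn D ζ) :=
        EReal.limsup_add_le (.inr (by simp [hlim])) (.inr (by simp [hlim]))
    _ ≤ f ζ + -(f ζ : EReal) := add_le_add (hu ζ hζ) hlim.le
    _ ≤ (0 : ℝ) := by norm_cast; simp

theorem HasMeanValueOn.perron_eq (hF : HasMeanValueOn F D) (hD : IsOpen D)
    (hlim : ∀ ζ ∈ sphereBoundary D, Tendsto F (nhdsIn D ζ) (𝓝 (f ζ))) {z : ℂ} (hz : z ∈ D) :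
    perron D f z = F z := by
  refine le_antisymm (sSup_le ?_) (le_sSup ⟨_, hF.isSubharmonicOn hD, fun ζ hζ => ?_, rfl⟩)
  · rintro y ⟨u, hu, hub, rfl⟩
    have := (hu.sub_hasMeanValueOn hF).le_of_boundaryLE_const (hub.sub_of_tendsto hlim) hz
    simpa [EReal.sub_le_iff_le_add] using this
  · change limsup _ (nhdsIn D ζ) ≤ _
    rcases (nhdsIn D ζ).eq_or_neBot with hbot | _
    · simp [hbot]
    · exact ((continuous_coe_real_ereal.tendsto _).comp (hlim ζ hζ)).limsup_eq.le

theorem isHarmonicMeasure_of_forall_solution (hD : IsOpen D) {z : ℂ} (hz : z ∈ D)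
    {μ : Measure (OnePoint ℂ)} [IsFiniteMeasure μ] (hμ : μ (sphereBoundary D)ᶜ = 0)
    (hsol : ∀ f : OnePoint ℂ → ℝ, ContinuousOn f (sphereBoundary D) →
      ∃ F : ℂ → ℝ, HasMeanValueOn F D ∧
        (∀ ζ ∈ sphereBoundary D, Tendsto F (nhdsIn D ζ) (𝓝 (f ζ))) ∧
        F z = ∫ w, f w ∂μ) :
    IsHarmonicMeasure D z μ := by
  refine ⟨‹_›, hμ, fun f hf => ?_⟩
  obtain ⟨F, hF, hlim, hFz⟩ := hsol f hf
  rw [Measure.restrict_eq_self_of_ae_mem (s := sphereBoundary D) (mem_ae_iff.2 hμ),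
    hF.perron_eq hD hlim hz, hFz]

theorem IsHarmonicMeasure.unique {z : ℂ} {μ μ' : Measure (OnePoint ℂ)}
    (h : IsHarmonicMeasure D z μ) (h' : IsHarmonicMeasure D z μ') : μ = μ' := by
  have : TopologicalSpace.MetrizableSpace (OnePoint ℂ) :=
    (onePointEquivSphereOfFinrankEq (ι := Fin 3) (V := ℂ)
      (by simp [Complex.finrank_real_complex])).isEmbedding.metrizableSpace
  have integral_eq_perron {μ : Measure (OnePoint ℂ)} (hμ : IsHarmonicMeasure D z μ)
      (f : C(OnePoint ℂ, ℝ)) : ((∫ w, f w ∂μ : ℝ) : EReal) = perron D f z := by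
    rw [← hμ.2.2 f f.continuous.continuousOn,
      Measure.restrict_eq_self_of_ae_mem (s := sphereBoundary D) (mem_ae_iff.2 hμ.2.1)]
  have := h.1
  have := h'.1
  refine ext_of_forall_integral_eq_of_IsFiniteMeasure fun f => ?_
  exact_mod_cast (integral_eq_perron h f).trans (integral_eq_perron h' f).symm

theorem IsHarmonicMeasure.harmonicMeasure_eq {z : ℂ} {μ : Measure (OnePoint ℂ)}
    (h : IsHarmonicMeasure D z μ) : harmonicMeasure D z = μ := by
  have hex : ∃ μ, IsHarmonicMeasure D z μ := ⟨μ, h⟩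
  rw [harmonicMeasure, dif_pos hex]
  exact hex.choose_spec.unique h

end Dirichlet

/-! ### The Poisson kernel of the upper half-plane -/

section HalfPlane

open scoped BoundedContinuousFunction NNReal
open ProbabilityTheory (cauchyMeasure cauchyPDFReal cauchyPDF)

theorem cauchyMeasure_eq_map (x₀ : ℝ) (γ : ℝ≥0) :
    cauchyMeasure x₀ γ = (cauchyMeasure 0 1).map fun t => γ * t + x₀ := by
  rcases eq_or_ne γ 0 with rfl | hγ
  · simp
  have hγ₀ : (γ : ℝ) ≠ 0 := NNReal.coe_ne_zero.2 hγ
  have hsurj : Function.Surjective fun t : ℝ => γ * t + x₀ := fun s =>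
    ⟨(s - x₀) / γ, by field_simp; ring⟩
  have hinj : Function.Injective fun t : ℝ => γ * t + x₀ := fun s t h => by
    simpa [hγ₀] using h
  ext B hB
  have hB' : MeasurableSet ((fun t : ℝ => γ * t + x₀) ⁻¹' B) := hB.preimage (by fun_prop)
  rw [Measure.map_apply (by fun_prop) hB,
    ProbabilityTheory.cauchyMeasure_of_scale_ne_zero _ hγ,
    ProbabilityTheory.cauchyMeasure_of_scale_ne_zero _ one_ne_zero, withDensity_apply _ hB,
    withDensity_apply _ hB', ← hsurj.image_preimage B,
    lintegral_image_eq_lintegral_abs_deriv_mul (f' := fun _ => γ) hB'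
      (fun t _ => by simpa using (((hasDerivAt_id t).const_mul (γ : ℝ)).add_const x₀)
        |>.hasDerivWithinAt) hinj.injOn, hsurj.image_preimage B]
  refine lintegral_congr fun t => ?_
  rw [NNReal.abs_eq, cauchyPDF, cauchyPDF, ← ENNReal.ofReal_mul (NNReal.coe_nonneg γ)]
  congr 1
  simp only [ProbabilityTheory.cauchyPDFReal_def, NNReal.coe_one]
  have : (γ * t + x₀ - x₀) ^ 2 + (γ : ℝ) ^ 2 = γ ^ 2 * (t ^ 2 + 1) := by ring
  rw [this]
  field_simp
  simp

/-- The harmonic measure of the upper half-plane at `w`, on the real line: a Cauchy distribution,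
which degenerates to the Dirac measure at `w` for real `w`. -/
def halfPlaneMeasure (w : ℂ) : Measure ℝ := cauchyMeasure w.re w.im.toNNReal

instance (w : ℂ) : IsProbabilityMeasure (halfPlaneMeasure w) := by
  unfold halfPlaneMeasure; infer_instance

/-- The Poisson kernel of the upper half-plane. -/
def halfPlaneKernel (w : ℂ) (s : ℝ) : ℝ := w.im / (π * ‖(s : ℂ) - w‖ ^ 2)

variable {w : ℂ} {R s : ℝ}

theorem halfPlaneMeasure_ofReal (s : ℝ) : halfPlaneMeasure s = Measure.dirac s := by
  simp [halfPlaneMeasure]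

theorem halfPlaneKernel_eq_cauchyPDFReal (hw : 0 ≤ w.im) :
    halfPlaneKernel w = cauchyPDFReal w.re w.im.toNNReal := by
  ext s
  have hnorm : ‖(s : ℂ) - w‖ ^ 2 = (s - w.re) ^ 2 + w.im ^ 2 := by
    rw [Complex.sq_norm, Complex.normSq_apply]; simp; ring
  rw [halfPlaneKernel, ProbabilityTheory.cauchyPDFReal_def, Real.coe_toNNReal _ hw, hnorm,
    ← div_div, div_eq_mul_inv, div_eq_inv_mul]

theorem halfPlaneKernel_nonneg (hw : 0 ≤ w.im) (s : ℝ) : 0 ≤ halfPlaneKernel w s := by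
  unfold halfPlaneKernel; positivity

theorem halfPlaneKernel_eq_im (w : ℂ) (s : ℝ) :
    halfPlaneKernel w s = π⁻¹ * (1 / ((s : ℂ) - w)).im := by
  simp [halfPlaneKernel, Complex.inv_im, Complex.normSq_eq_norm_sq, div_eq_mul_inv]
  ring

theorem measurable_halfPlaneKernel : Measurable fun q : ℂ × ℝ => halfPlaneKernel q.1 q.2 := by
  unfold halfPlaneKernel; fun_prop

theorem measurable_halfPlaneKernel_right (w : ℂ) : Measurable (halfPlaneKernel w) :=
  measurable_halfPlaneKernel.comp measurable_prodMk_left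

theorem integrable_halfPlaneKernel (hw : 0 ≤ w.im) : Integrable (halfPlaneKernel w) := by
  rw [halfPlaneKernel_eq_cauchyPDFReal hw]
  exact ProbabilityTheory.integrable_cauchyPDFReal _

theorem integral_halfPlaneKernel (hw : 0 < w.im) : ∫ s, halfPlaneKernel w s = 1 := by
  rw [halfPlaneKernel_eq_cauchyPDFReal hw.le]
  exact ProbabilityTheory.integral_cauchyPDFReal_eq_one _ (Real.toNNReal_pos.2 hw).ne'

theorem halfPlaneMeasure_eq_withDensity (hw : 0 < w.im) :
    halfPlaneMeasure w = volume.withDensity fun s => ENNReal.ofReal (halfPlaneKernel w s) := by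
  rw [halfPlaneMeasure,
    ProbabilityTheory.cauchyMeasure_of_scale_ne_zero _ (Real.toNNReal_pos.2 hw).ne',
    halfPlaneKernel_eq_cauchyPDFReal hw.le]
  rfl

theorem integral_halfPlaneMeasure (hw : 0 < w.im) (h : ℝ → ℝ) :
    ∫ s, h s ∂halfPlaneMeasure w = ∫ s, halfPlaneKernel w s * h s := by
  rw [halfPlaneMeasure_eq_withDensity hw, integral_withDensity_eq_integral_toReal_smul
    (measurable_halfPlaneKernel_right w).ennreal_ofReal
    (ae_of_all _ fun _ => ENNReal.ofReal_lt_top)]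
  simp only [smul_eq_mul, ENNReal.toReal_ofReal (halfPlaneKernel_nonneg hw.le _)]

theorem measurable_halfPlaneMeasure_apply {B : Set ℝ} (hB : MeasurableSet B) :
    Measurable fun w => halfPlaneMeasure w B := by
  have hmeas : Measurable fun q : ℂ × ℝ => (q.1.im.toNNReal : ℝ) * q.2 + q.1.re := by fun_prop
  simp only [halfPlaneMeasure, cauchyMeasure_eq_map _ (Real.toNNReal _)]
  have happly : ∀ w : ℂ, (cauchyMeasure 0 1).map (fun t => (w.im.toNNReal : ℝ) * t + w.re) B
      = cauchyMeasure 0 1 {t | w.im.toNNReal * t + w.re ∈ B} := fun w =>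
    Measure.map_apply (by fun_prop) hB
  simp only [happly]
  exact measurable_measure_prodMk_left (hmeas hB)

theorem continuous_integral_halfPlaneMeasure (h : ℝ →ᵇ ℝ) :
    Continuous fun w => ∫ s, h s ∂halfPlaneMeasure w := by
  have heq : ∀ w : ℂ, ∫ s, h s ∂halfPlaneMeasure w
      = ∫ t, h (w.im.toNNReal * t + w.re) ∂cauchyMeasure 0 1 := fun w => by
    rw [halfPlaneMeasure, cauchyMeasure_eq_map,
      integral_map (by fun_prop) h.continuous.aestronglyMeasurable]
  simp only [heq]
  exact continuous_of_dominated (bound := fun _ => ‖h‖)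
    (fun w => (h.continuous.comp (by fun_prop)).aestronglyMeasurable)
    (fun w => ae_of_all _ fun t => h.norm_coe_le_norm _) (integrable_const _)
    (ae_of_all _ fun t => h.continuous.comp (by fun_prop))

/-! ### The mean value property of Poisson integrals -/

theorem circleAverage_integral_comm {X : Type*} [MeasurableSpace X] {μ : Measure X} [SFinite μ]
    {F : ℂ → X → ℝ} {c : ℂ} {r : ℝ}
    (hF : Integrable (Function.uncurry fun θ x => F (circleMap c r θ) x)
      ((volume.restrict (Ioc 0 (2 * π))).prod μ)) :
    Real.circleAverage (fun z => ∫ x, F z x ∂μ) c r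
      = ∫ x, Real.circleAverage (fun z => F z x) c r ∂μ := by
  simp only [Real.circleAverage, intervalIntegral.integral_of_le Real.two_pi_pos.le]
  rw [integral_integral_swap hF, integral_smul]

variable {D : Set ℂ} {W : ℂ → ℂ} {z : ℂ} {r : ℝ}

theorem circleAverage_halfPlaneKernel (hW : DifferentiableOn ℂ W D)
    (hWim : ∀ z ∈ D, 0 < (W z).im) (hr : 0 < r) (hzr : closedBall z r ⊆ D) (s : ℝ) :
    Real.circleAverage (fun z => halfPlaneKernel (W z) s) z r = halfPlaneKernel (W z) s := by
  set g : ℂ → ℂ := fun z => 1 / ((s : ℂ) - W z)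
  have hg : DifferentiableOn ℂ g D := by
    refine DifferentiableOn.div (by fun_prop) (by fun_prop) fun z hz h => (hWim z hz).ne' ?_
    simpa using congrArg Complex.im h
  have hg_avg : Real.circleAverage g z r = g z :=
    DiffContOnCl.circleAverage (by rw [abs_of_pos hr]; exact hg.diffContOnCl_ball hzr)
  have hg_int : CircleIntegrable g z r :=
    (hg.continuousOn.mono (sphere_subset_closedBall.trans hzr)).circleIntegrable hr.le
  have heq : (fun z => halfPlaneKernel (W z) s) = π⁻¹ • (Complex.imCLM ∘ g) := by
    ext z; exact halfPlaneKernel_eq_im _ _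
  rw [heq, Real.circleAverage_smul, Complex.imCLM.circleAverage_comp_comm hg_int, hg_avg,
    halfPlaneKernel_eq_im]
  rfl

theorem integrable_halfPlaneKernel_comp {f : ℝ → ℂ} (hf : Continuous f)
    (hfim : ∀ θ, 0 < (f θ).im) (a b : ℝ) :
    Integrable (fun q : ℝ × ℝ => halfPlaneKernel (f q.1) q.2)
      ((volume.restrict (Ioc a b)).prod volume) := by
  have hmeas : Measurable fun q : ℝ × ℝ => halfPlaneKernel (f q.1) q.2 :=
    measurable_halfPlaneKernel.comp ((hf.measurable.comp measurable_fst).prodMk measurable_snd)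
  refine (integrable_prod_iff hmeas.aestronglyMeasurable).2
    ⟨ae_of_all _ fun θ => integrable_halfPlaneKernel (hfim θ).le, ?_⟩
  simp only [Real.norm_of_nonneg (halfPlaneKernel_nonneg (hfim _).le _),
    integral_halfPlaneKernel (hfim _)]
  exact integrable_const _

theorem hasMeanValueOn_integral_halfPlaneMeasure (hW : DifferentiableOn ℂ W D)
    (hWim : ∀ z ∈ D, 0 < (W z).im) (h : ℝ →ᵇ ℝ) :
    HasMeanValueOn (fun z => ∫ s, h s ∂halfPlaneMeasure (W z)) D := by
  refine ⟨(continuous_integral_halfPlaneMeasure h).comp_continuousOn hW.continuousOn,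
    fun z r hr hzr => ?_⟩
  have hz : z ∈ D := hzr (mem_closedBall_self hr.le)
  have hmem : ∀ θ, circleMap z r θ ∈ D := fun θ =>
    hzr (sphere_subset_closedBall (circleMap_mem_sphere z hr.le θ))
  have hint : Integrable (Function.uncurry fun θ s =>
      halfPlaneKernel (W (circleMap z r θ)) s * h s)
      ((volume.restrict (Ioc 0 (2 * π))).prod volume) :=
    (integrable_halfPlaneKernel_comp
      (hW.continuousOn.comp_continuous (continuous_circleMap z r) hmem)
      (fun θ => hWim _ (hmem θ)) 0 (2 * π)).mul_bdd (c := ‖h‖)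
      (h.continuous.comp continuous_snd).aestronglyMeasurable
      (ae_of_all _ fun q => h.norm_coe_le_norm _)
  calc Real.circleAverage (fun z => ∫ s, h s ∂halfPlaneMeasure (W z)) z r
      = Real.circleAverage (fun z => ∫ s, halfPlaneKernel (W z) s * h s) z r :=
        Real.circleAverage_congr_sphere fun w hw => by
          rw [abs_of_pos hr] at hw
          exact integral_halfPlaneMeasure (hWim w (hzr (sphere_subset_closedBall hw))) h
    _ = ∫ s, Real.circleAverage (fun z => halfPlaneKernel (W z) s * h s) z r :=
        circleAverage_integral_comm hint
    _ = ∫ s, halfPlaneKernel (W z) s * h s := by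
        refine integral_congr_ae (ae_of_all _ fun s => ?_)
        simp only [mul_comm _ (h s), ← smul_eq_mul, Real.circleAverage_fun_smul,
          circleAverage_halfPlaneKernel hW hWim hr hzr]
    _ = ∫ s, h s ∂halfPlaneMeasure (W z) := (integral_halfPlaneMeasure (hWim z hz) h).symm

/-! ### Harmonic measure of a short interval seen from afar -/

theorem halfPlaneKernel_le (hw : 0 < w.im) (hs : |s| ≤ R) (hR : 2 * R ≤ ‖w‖) :
    halfPlaneKernel w s ≤ 4 / π * -(1 / w).im := by
  have hw₀ : 0 < ‖w‖ := norm_pos_iff.2 (by rintro rfl; simp at hw)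
  have hnorm : ‖w‖ / 2 ≤ ‖(s : ℂ) - w‖ := by
    have := norm_sub_norm_le w s
    rw [norm_sub_rev, Complex.norm_real, Real.norm_eq_abs] at this
    linarith
  calc w.im / (π * ‖(s : ℂ) - w‖ ^ 2) ≤ w.im / (π * (‖w‖ / 2) ^ 2) := by gcongr
    _ = 4 / π * -(1 / w).im := by
      rw [one_div, Complex.inv_im, Complex.normSq_eq_norm_sq]; field_simp; norm_num

theorem le_halfPlaneKernel (hw : 0 < w.im) (hs : |s| ≤ R) (hR : R ≤ ‖w‖) :
    1 / (4 * π) * -(1 / w).im ≤ halfPlaneKernel w s := by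
  have hw₀ : 0 < ‖w‖ := norm_pos_iff.2 (by rintro rfl; simp at hw)
  have hnorm : ‖(s : ℂ) - w‖ ≤ 2 * ‖w‖ := by
    have := norm_sub_le (s : ℂ) w
    rw [Complex.norm_real, Real.norm_eq_abs] at this
    linarith
  have hpos : 0 < ‖(s : ℂ) - w‖ :=
    norm_pos_iff.2 fun h => hw.ne' (by simpa using congrArg Complex.im h)
  calc 1 / (4 * π) * -(1 / w).im = w.im / (π * (2 * ‖w‖) ^ 2) := by
        rw [one_div, one_div, Complex.inv_im, Complex.normSq_eq_norm_sq]; field_simp; norm_num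
    _ ≤ w.im / (π * ‖(s : ℂ) - w‖ ^ 2) := by gcongr

theorem halfPlaneMeasure_Icc_le (hw : 0 < w.im) (hR₀ : 0 ≤ R) (hR : 2 * R ≤ ‖w‖) :
    halfPlaneMeasure w (Icc (-R) R) ≤ ENNReal.ofReal (8 / π * R * -(1 / w).im) := by
  rw [halfPlaneMeasure_eq_withDensity hw, withDensity_apply _ measurableSet_Icc]
  calc ∫⁻ s in Icc (-R) R, ENNReal.ofReal (halfPlaneKernel w s)
      ≤ ∫⁻ _ in Icc (-R) R, ENNReal.ofReal (4 / π * -(1 / w).im) :=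
        setLIntegral_mono measurable_const fun s hs =>
          ENNReal.ofReal_le_ofReal (halfPlaneKernel_le hw (abs_le.2 hs) hR)
    _ = ENNReal.ofReal (8 / π * R * -(1 / w).im) := by
        rw [setLIntegral_const, Real.volume_Icc, ← ENNReal.ofReal_mul' (by linarith)]
        congr 1; ring

theorem le_halfPlaneMeasure_Ioo (hw : 0 < w.im) (hR₀ : 0 ≤ R) (hR : R ≤ ‖w‖) :
    ENNReal.ofReal (R / (2 * π) * -(1 / w).im) ≤ halfPlaneMeasure w (Ioo (-R) R) := by
  rw [halfPlaneMeasure_eq_withDensity hw, withDensity_apply _ measurableSet_Ioo]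
  calc ENNReal.ofReal (R / (2 * π) * -(1 / w).im)
      = ∫⁻ _ in Ioo (-R) R, ENNReal.ofReal (1 / (4 * π) * -(1 / w).im) := by
        rw [setLIntegral_const, Real.volume_Ioo, ← ENNReal.ofReal_mul' (by linarith)]
        congr 1; field_simp; ring
    _ ≤ ∫⁻ s in Ioo (-R) R, ENNReal.ofReal (halfPlaneKernel w s) :=
        setLIntegral_mono (measurable_halfPlaneKernel_right w).ennreal_ofReal fun s hs =>
          ENNReal.ofReal_le_ofReal (le_halfPlaneKernel hw (abs_lt.2 hs).le hR)

theorem tendsto_halfPlaneMeasure_isCompact {K : Set ℝ} (hK : IsCompact K) :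
    Tendsto (fun w => halfPlaneMeasure w K) (cocompact ℂ ⊓ 𝓟 {w | 0 < w.im}) (𝓝 0) := by
  obtain ⟨R, hR₀, hKR⟩ := hK.isBounded.subset_closedBall_lt 0 0
  rw [Real.closedBall_eq_Icc, zero_sub, zero_add] at hKR
  have hlim : Tendsto (fun w : ℂ => ENNReal.ofReal (8 / π * R * ‖1 / w‖))
      (cocompact ℂ ⊓ 𝓟 {w | 0 < w.im}) (𝓝 0) := by
    have := (tendsto_inv₀_cobounded (α := ℂ)).norm.const_mul (8 / π * R)
    rw [cobounded_eq_cocompact, norm_zero, mul_zero] at this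
    simpa using ENNReal.tendsto_ofReal (this.mono_left inf_le_left)
  refine tendsto_of_tendsto_of_tendsto_of_le_of_le' tendsto_const_nhds hlim
    (Eventually.of_forall fun _ => zero_le) (eventually_inf_principal.2 ?_)
  filter_upwards [(tendsto_norm_cocompact_atTop (E := ℂ)).eventually_ge_atTop (2 * R)] with w hw
    hw₀
  refine (measure_mono hKR).trans ((halfPlaneMeasure_Icc_le hw₀ hR₀.le hw).trans ?_)
  gcongr
  exact (neg_le_abs _).trans (Complex.abs_im_le_norm _)

end HalfPlane

theorem tendsto_integral_of_tendsto_cocompact {X ι : Type*} [TopologicalSpace X] [T2Space X]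
    [MeasurableSpace X] [OpensMeasurableSpace X] {l : Filter ι} {μ : ι → Measure X}
    [∀ i, IsProbabilityMeasure (μ i)]
    (hμ : ∀ K, IsCompact K → Tendsto (fun i => μ i K) l (𝓝 0))
    (h : BoundedContinuousFunction X ℝ) {a : ℝ} (ha : Tendsto h (cocompact X) (𝓝 a)) :
    Tendsto (fun i => ∫ x, h x ∂μ i) l (𝓝 a) := by
  refine Metric.tendsto_nhds.2 fun ε hε => ?_
  obtain ⟨K, hK, hKε⟩ := mem_cocompact.1 (Metric.tendsto_nhds.1 ha (ε / 2) (half_pos hε))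
  have hlim : Tendsto (fun i => ε / 2 + (μ i).real K * (‖h‖ + ‖a‖)) l (𝓝 (ε / 2)) := by
    have := (ENNReal.tendsto_toReal ENNReal.zero_ne_top).comp (hμ K hK)
    simpa [Measure.real] using (this.mul_const (‖h‖ + ‖a‖)).const_add (ε / 2)
  filter_upwards [hlim.eventually_lt_const (half_lt_self hε)] with i hi
  have hbound : ∀ x, ‖h x - a‖ ≤ ε / 2 + K.indicator (fun _ => ‖h‖ + ‖a‖) x := fun x => by
    by_cases hx : x ∈ K
    · rw [indicator_of_mem hx]
      have := (norm_sub_le (h x) a).trans (add_le_add_left (h.norm_coe_le_norm x) _)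
      linarith
    · rw [indicator_of_notMem hx, add_zero]
      exact (show dist (h x) a < ε / 2 from hKε hx).le
  have hind : Integrable (K.indicator fun _ => ‖h‖ + ‖a‖) (μ i) :=
    (integrable_const _).indicator hK.measurableSet
  calc dist (∫ x, h x ∂μ i) a = ‖∫ x, (h x - a) ∂μ i‖ := by
        rw [integral_sub (h.integrable _) (integrable_const _), dist_eq_norm]; simp
    _ ≤ ∫ x, (ε / 2 + K.indicator (fun _ => ‖h‖ + ‖a‖) x) ∂μ i :=
        norm_integral_le_of_norm_le ((integrable_const _).add hind) (ae_of_all _ hbound)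
    _ = ε / 2 + (μ i).real K * (‖h‖ + ‖a‖) := by
        rw [integral_add (integrable_const _) hind, integral_indicator hK.measurableSet]; simp
    _ < ε := hi

/-! ### Angles and the upper half-plane -/

section Angle

open scoped BoundedContinuousFunction

variable {α β r θ : ℝ} {z w : ℂ}

theorem openAngle_eq_image_exp (α β : ℝ) :
    openAngle α β = Complex.exp '' (Complex.im ⁻¹' Ioo α β) := by
  ext z
  constructor
  · rintro ⟨r, θ, hr, hαθ, hθβ, rfl⟩
    refine ⟨Real.log r + θ * I, by simp [hαθ, hθβ], ?_⟩
    rw [Complex.exp_add, ← Complex.ofReal_exp, Real.exp_log hr]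
  · rintro ⟨w, hw, rfl⟩
    refine ⟨Real.exp w.re, w.im, Real.exp_pos _, hw.1, hw.2, ?_⟩
    rw [Complex.ofReal_exp, ← Complex.exp_add, Complex.re_add_im]

theorem isOpen_openAngle (α β : ℝ) : IsOpen (openAngle α β) := by
  rw [openAngle_eq_image_exp]
  exact Complex.isOpenMap_exp _ (isOpen_Ioo.preimage Complex.continuous_im)

theorem isPreconnected_openAngle (α β : ℝ) : IsPreconnected (openAngle α β) := by
  rw [openAngle_eq_image_exp]
  exact ((convex_Ioo α β).linear_preimage Complex.imLm).isPreconnected.image _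
    Complex.continuous_exp.continuousOn

theorem circleMap_mem_openAngle_iff (hβ : β ≤ α + 2 * π) (hr : 0 ≤ r)
    (hθ : θ ∈ Icc α (α + 2 * π)) :
    circleMap 0 r θ ∈ openAngle α β ↔ 0 < r ∧ θ ∈ Ioo α β := by
  constructor
  · rintro ⟨r', θ', hr', hαθ', hθ'β, h⟩
    rw [← circleMap_zero] at h
    obtain rfl : r = r' := by
      simpa [abs_of_nonneg hr, abs_of_pos hr'] using congrArg norm h
    obtain rfl : θ = θ' := eq_of_circleMap_eq hr'.ne'
      (abs_lt.2 ⟨by linarith [hθ.1], by linarith [hθ.2]⟩) h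
    exact ⟨hr', hαθ', hθ'β⟩
  · rintro ⟨hr, hθ⟩
    exact ⟨r, θ, hr, hθ.1, hθ.2, circleMap_zero r θ⟩

/-- The exponent `π / (β - α)` of the power map of `∠(α, β)` onto the upper half-plane. -/
def angleExponent (α β : ℝ) : ℝ := π / (β - α)

theorem angleExponent_pos (hαβ : α < β) : 0 < angleExponent α β :=
  div_pos Real.pi_pos (sub_pos.2 hαβ)

theorem half_le_angleExponent (hαβ : α < β) (hβ : β ≤ α + 2 * π) :
    1 / 2 ≤ angleExponent α β := by
  rw [angleExponent, div_le_div_iff₀ two_pos (sub_pos.2 hαβ)]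
  linarith

theorem inv_angleExponent_mul_pi (α β : ℝ) : (angleExponent α β)⁻¹ * π = β - α := by
  rw [angleExponent, inv_div, div_mul_cancel₀ _ Real.pi_ne_zero]

theorem angleExponent_mul_mem (hθ : θ ∈ Ioo α β) :
    angleExponent α β * (θ - α) ∈ Ioo 0 π := by
  have hκ := angleExponent_pos (hθ.1.trans hθ.2)
  refine ⟨mul_pos hκ (sub_pos.2 hθ.1), ?_⟩
  rw [← lt_inv_mul_iff₀ hκ, inv_angleExponent_mul_pi]
  linarith [hθ.2]

theorem neg_exp_mul_exp (α : ℝ) (w : ℂ) :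
    -(Complex.exp w * Complex.exp (-(α : ℂ) * I)) = Complex.exp (w - α * I - π * I) := by
  rw [Complex.exp_sub_pi_mul_I, ← Complex.exp_add, neg_mul, sub_eq_add_neg]

theorem angleReduction_exp (hβ : β ≤ α + 2 * π) (hw : w.im ∈ Ioo α β) :
    angleReduction α β (Complex.exp w) = Complex.exp (angleExponent α β * (w - α * I)) := by
  rw [angleReduction, neg_exp_mul_exp, Complex.log_exp (by simp; linarith [hw.1])
    (by simp; linarith [hw.2]), sub_add_cancel, angleExponent]

theorem im_angleExponent_mul_mem (hw : w.im ∈ Ioo α β) :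
    (angleExponent α β * (w - α * I)).im ∈ Ioo 0 π := by
  simpa using angleExponent_mul_mem hw

theorem angleReduction_im_pos (hβ : β ≤ α + 2 * π) (hz : z ∈ openAngle α β) :
    0 < (angleReduction α β z).im := by
  rw [openAngle_eq_image_exp] at hz
  obtain ⟨w, hw, rfl⟩ := hz
  rw [angleReduction_exp hβ hw, Complex.exp_im]
  exact mul_pos (Real.exp_pos _) (Real.sin_pos_of_mem_Ioo (im_angleExponent_mul_mem hw))

theorem norm_angleReduction (hβ : β ≤ α + 2 * π) (hz : z ∈ openAngle α β) :
    ‖angleReduction α β z‖ = ‖z‖ ^ angleExponent α β := by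
  rw [openAngle_eq_image_exp] at hz
  obtain ⟨w, hw, rfl⟩ := hz
  rw [angleReduction_exp hβ hw, Complex.norm_exp, Complex.norm_exp, ← Real.exp_mul]
  simp [mul_comm]

theorem differentiableOn_angleReduction (hβ : β ≤ α + 2 * π) :
    DifferentiableOn ℂ (angleReduction α β) (openAngle α β) := by
  intro z hz
  have hslit : -(z * Complex.exp (-(α : ℂ) * I)) ∈ Complex.slitPlane := by
    rw [openAngle_eq_image_exp] at hz
    obtain ⟨w, hw, rfl⟩ := hz
    have him : (w - α * I - π * I).im ∈ Ioo (-π) π := by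
      simp only [Complex.sub_im, Complex.im_ofReal_mul, Complex.I_im,
        mul_one]
      exact ⟨by linarith [hw.1], by linarith [hw.2]⟩
    rw [neg_exp_mul_exp, Complex.mem_slitPlane_iff_arg,
      Complex.arg_exp, (toIocMod_eq_self _).2 ⟨him.1, by linarith [him.2]⟩]
    exact ⟨him.2.ne, Complex.exp_ne_zero _⟩
  unfold angleReduction
  have hlog : DifferentiableAt ℂ
      (fun z => Complex.log (-(z * Complex.exp (-(α : ℂ) * I)))) z :=
    DifferentiableAt.clog (by fun_prop) hslit
  exact ((hlog.add_const _).const_mul _).cexp.differentiableWithinAt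

/-- The map `w ↦ w^{(β-α)/π} e^{iα}` of the closed upper half-plane onto the closed angle, whose
restriction to the open half-plane is the inverse of `angleReduction α β`. -/
def angleParam (α β : ℝ) (w : ℂ) : ℂ :=
  w ^ (((angleExponent α β)⁻¹ : ℝ) : ℂ) * Complex.exp (α * I)

theorem angleParam_eq_exp (α β : ℝ) (hw : w ≠ 0) :
    angleParam α β w = Complex.exp (((angleExponent α β)⁻¹ : ℝ) * Complex.log w + α * I) := by
  rw [angleParam, Complex.cpow_def_of_ne_zero hw, Complex.exp_add, mul_comm (Complex.log w)]

theorem norm_angleParam (α β : ℝ) (w : ℂ) :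
    ‖angleParam α β w‖ = ‖w‖ ^ (angleExponent α β)⁻¹ := by
  rw [angleParam, norm_mul, Complex.norm_exp_ofReal_mul_I, mul_one, Complex.norm_cpow_real]

theorem angleParam_angleReduction (hβ : β ≤ α + 2 * π) (hz : z ∈ openAngle α β) :
    angleParam α β (angleReduction α β z) = z := by
  rw [openAngle_eq_image_exp] at hz
  obtain ⟨w, hw, rfl⟩ := hz
  have hκ : (angleExponent α β : ℂ) ≠ 0 :=
    Complex.ofReal_ne_zero.2 (angleExponent_pos (hw.1.trans hw.2)).ne'
  have him := im_angleExponent_mul_mem hw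
  rw [angleReduction_exp hβ hw, angleParam_eq_exp _ _ (Complex.exp_ne_zero _),
    Complex.log_exp (by linarith [him.1, Real.pi_pos]) him.2.le, Complex.ofReal_inv,
    inv_mul_cancel_left₀ hκ, sub_add_cancel]

theorem angleParam_mem (hαβ : α < β) (hw : 0 < w.im) : angleParam α β w ∈ openAngle α β := by
  have hw₀ : w ≠ 0 := by rintro rfl; simp at hw
  have harg_pos : 0 < w.arg := (Complex.arg_nonneg_iff.2 hw.le).lt_of_ne'
    fun h => hw.ne' (Complex.arg_eq_zero_iff.1 h).2
  have harg_lt : w.arg < π := Complex.arg_lt_pi_iff.2 (Or.inr hw.ne')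
  have hκ := inv_pos.2 (angleExponent_pos hαβ)
  rw [openAngle_eq_image_exp, angleParam_eq_exp _ _ hw₀]
  refine mem_image_of_mem _ ?_
  have hmul := mul_lt_mul_of_pos_left harg_lt hκ
  rw [inv_angleExponent_mul_pi] at hmul
  simp only [mem_preimage, Complex.add_im, Complex.im_ofReal_mul, Complex.log_im, Complex.I_im,
    mul_one]
  exact ⟨by linarith [mul_pos hκ harg_pos], by linarith⟩

theorem continuousOn_angleParam (hαβ : α < β) :
    ContinuousOn (angleParam α β) {w | 0 ≤ w.im} := by
  have hκ := inv_pos.2 (angleExponent_pos hαβ)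
  intro w hw
  rcases le_or_gt 0 w.re with hre | hre
  · exact (Complex.continuousAt_cpow_const_of_re_pos (Or.inl hre) (by simpa using hκ)).mul
      continuousAt_const |>.continuousWithinAt
  have hlog : ContinuousWithinAt Complex.log {w | 0 ≤ w.im} w := by
    rcases eq_or_ne w.im 0 with him | him
    · exact Complex.continuousWithinAt_log_of_re_neg_of_im_zero hre him
    · exact (continuousAt_clog (Or.inr him)).continuousWithinAt
  have hne : ∀ᶠ w' in 𝓝[{w | 0 ≤ w.im}] w, w' ≠ 0 :=
    nhdsWithin_le_nhds (isOpen_ne.mem_nhds (by rintro rfl; simp at hre))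
  exact ((continuousWithinAt_const.mul hlog).add continuousWithinAt_const).cexp
    |>.congr_of_eventuallyEq (hne.mono fun w' => angleParam_eq_exp α β)
      (angleParam_eq_exp _ _ (by rintro rfl; simp at hre))

theorem continuous_angleParam_ofReal (hαβ : α < β) :
    Continuous fun s : ℝ => angleParam α β s :=
  (continuousOn_angleParam hαβ).comp_continuous Complex.continuous_ofReal (by simp)

theorem angleParam_ofReal_of_nonneg (α β : ℝ) {s : ℝ} (hs : 0 ≤ s) :
    angleParam α β s = circleMap 0 (s ^ (angleExponent α β)⁻¹) α := by
  rw [angleParam, circleMap_zero, ← Complex.ofReal_cpow hs]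

theorem angleParam_ofReal_of_nonpos (α β : ℝ) {s : ℝ} (hs : s ≤ 0) :
    angleParam α β s = circleMap 0 ((-s) ^ (angleExponent α β)⁻¹) β := by
  have hexp : (π : ℂ) * I * ((angleExponent α β)⁻¹ : ℝ) + α * I = β * I := by
    rw [mul_right_comm, mul_comm (π : ℂ), ← Complex.ofReal_mul, inv_angleExponent_mul_pi]
    push_cast; ring
  rw [angleParam, circleMap_zero, Complex.ofReal_cpow_of_nonpos hs, mul_assoc, ← Complex.exp_add,
    hexp, Complex.ofReal_cpow (neg_nonneg.2 hs), Complex.ofReal_neg]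

theorem angleParam_ofReal_notMem (hαβ : α < β) (hβ : β ≤ α + 2 * π) (s : ℝ) :
    angleParam α β s ∉ openAngle α β := by
  have hnonneg := Real.rpow_nonneg (abs_nonneg s) (angleExponent α β)⁻¹
  rcases le_total 0 s with hs | hs
  · rw [abs_of_nonneg hs] at hnonneg
    rw [angleParam_ofReal_of_nonneg _ _ hs,
      circleMap_mem_openAngle_iff hβ hnonneg ⟨le_rfl, by linarith⟩]
    exact fun h => h.2.1.false
  · rw [abs_of_nonpos hs] at hnonneg
    rw [angleParam_ofReal_of_nonpos _ _ hs, circleMap_mem_openAngle_iff hβ hnonneg ⟨hαβ.le, hβ⟩]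
    exact fun h => h.2.2.false

theorem coe_angleParam_ofReal_mem (hαβ : α < β) (hβ : β ≤ α + 2 * π) (s : ℝ) :
    (angleParam α β s : OnePoint ℂ) ∈ sphereBoundary (openAngle α β) := by
  have hs : (s : ℂ) ∈ closure {w : ℂ | 0 < w.im} := by
    rw [Complex.closure_setOfPred_lt_im]; simp
  have hcont : ContinuousWithinAt (angleParam α β) {w : ℂ | 0 < w.im} s :=
    (continuousOn_angleParam hαβ s (by simp)).mono fun w (hw : 0 < w.im) => hw.le
  have hmaps : MapsTo (angleParam α β) {w | 0 < w.im} (openAngle α β) := fun w hw =>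
    angleParam_mem hαβ hw
  have hclosure : angleParam α β s ∈ closure (openAngle α β) :=
    closure_mono hmaps.image_subset (hcont.mem_closure_image hs)
  have hopen := OnePoint.isOpenEmbedding_coe.isOpenMap _ (isOpen_openAngle α β)
  refine ⟨image_closure_subset_closure_image OnePoint.continuous_coe ⟨_, hclosure, rfl⟩, ?_⟩
  rw [hopen.interior_eq]
  exact fun h => angleParam_ofReal_notMem hαβ hβ s (OnePoint.coe_injective.mem_set_image.1 h)

theorem tendsto_angleParam_ofReal_infty (hαβ : α < β) :
    Tendsto (fun s : ℝ => (angleParam α β s : OnePoint ℂ)) (cocompact ℝ) (𝓝 OnePoint.infty) := by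
  have hparam : Tendsto (fun s : ℝ => angleParam α β s) (cocompact ℝ) (cocompact ℂ) := by
    rw [← cobounded_eq_cocompact (α := ℂ), ← tendsto_norm_atTop_iff_cobounded]
    simp only [norm_angleParam, Complex.norm_real]
    exact (tendsto_rpow_atTop (inv_pos.2 (angleExponent_pos hαβ))).comp
      tendsto_norm_cocompact_atTop
  rw [← coclosedCompact_eq_cocompact (X := ℂ), ← OnePoint.comap_coe_nhds_infty] at hparam
  exact tendsto_comap.comp hparam

theorem tendsto_angleReduction_infty (hαβ : α < β) (hβ : β ≤ α + 2 * π) :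
    Tendsto (angleReduction α β) (nhdsIn (openAngle α β) OnePoint.infty)
      (cocompact ℂ ⊓ 𝓟 {w | 0 < w.im}) := by
  rw [nhdsIn_infty]
  have hmem : ∀ᶠ z in cocompact ℂ ⊓ 𝓟 (openAngle α β), z ∈ openAngle α β :=
    mem_inf_of_right (mem_principal_self _)
  refine tendsto_inf.2 ⟨?_, tendsto_principal.2 (hmem.mono fun z => angleReduction_im_pos hβ)⟩
  rw [← cobounded_eq_cocompact (α := ℂ), ← tendsto_norm_atTop_iff_cobounded,
    cobounded_eq_cocompact]
  exact (((tendsto_rpow_atTop (angleExponent_pos hαβ)).comp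
    tendsto_norm_cocompact_atTop).mono_left inf_le_left).congr'
    (hmem.mono fun z hz => (norm_angleReduction hβ hz).symm)

theorem exists_tendsto_angleReduction (hαβ : α < β) (hβ : β ≤ α + 2 * π) {c : ℂ}
    (hc : c ∉ openAngle α β) {𝒰 : Ultrafilter ℂ} (h𝒰 : ↑𝒰 ≤ 𝓝[openAngle α β] c) :
    ∃ s : ℝ, angleParam α β s = c ∧ Tendsto (angleReduction α β) 𝒰 (𝓝 s) := by
  have hκ := angleExponent_pos hαβ
  have hnhds : Tendsto id (𝒰 : Filter ℂ) (𝓝 c) := h𝒰.trans nhdsWithin_le_nhds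
  have hmem : ∀ᶠ z in (𝒰 : Filter ℂ), z ∈ openAngle α β := h𝒰 self_mem_nhdsWithin
  have hK : IsCompact (closedBall 0 ((‖c‖ + 1) ^ angleExponent α β) ∩ {w : ℂ | 0 ≤ w.im}) :=
    (isCompact_closedBall _ _).inter_right (isClosed_le continuous_const Complex.continuous_im)
  have hmemK : ∀ᶠ z in (𝒰 : Filter ℂ), angleReduction α β z ∈
      closedBall 0 ((‖c‖ + 1) ^ angleExponent α β) ∩ {w : ℂ | 0 ≤ w.im} := by
    have hnorm : ∀ᶠ z in (𝒰 : Filter ℂ), ‖z‖ < ‖c‖ + 1 :=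
      hnhds (continuous_norm.continuousAt.eventually_lt_const (lt_add_one ‖c‖))
    filter_upwards [hmem, hnorm] with z hz hzc
    refine ⟨?_, (angleReduction_im_pos hβ hz).le⟩
    rw [mem_closedBall_zero_iff, norm_angleReduction hβ hz]
    exact Real.rpow_le_rpow (norm_nonneg _) hzc.le hκ.le
  obtain ⟨w, ⟨-, hw⟩, hlim : Tendsto (angleReduction α β) 𝒰 (𝓝 w)⟩ :=
    isCompact_iff_ultrafilter_le_nhds.1 hK (𝒰.map (angleReduction α β)) (le_principal_iff.2 hmemK)
  have hparam : angleParam α β w = c :=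
    tendsto_nhds_unique (((continuousOn_angleParam hαβ w hw).tendsto.comp
      (tendsto_nhdsWithin_iff.2 ⟨hlim, hmemK.mono fun z hz => hz.2⟩)))
      (hnhds.congr' (hmem.mono fun z hz => (angleParam_angleReduction hβ hz).symm))
  have him : w.im = 0 := by
    by_contra h
    exact hc (hparam ▸ angleParam_mem hαβ (lt_of_le_of_ne' hw h))
  obtain ⟨s, rfl⟩ : ∃ s : ℝ, (s : ℂ) = w := ⟨w.re, Complex.ext rfl (by simp [him])⟩
  exact ⟨s, hparam, hlim⟩

theorem closure_openAngle_subset (hαβ : α < β) (hβ : β ≤ α + 2 * π) :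
    closure (openAngle α β) ⊆ openAngle α β ∪ range fun s : ℝ => angleParam α β s := by
  intro c hc
  refine or_iff_not_imp_left.2 fun hcD => ?_
  have := mem_closure_iff_nhdsWithin_neBot.1 hc
  obtain ⟨s, hs, -⟩ := exists_tendsto_angleReduction hαβ hβ hcD (Ultrafilter.of_le (𝓝[_] c))
  exact ⟨s, hs⟩

/-! ### Harmonic measure of an angle -/

theorem tendsto_integral_angleReduction (hαβ : α < β) (hβ : β ≤ α + 2 * π)
    {f : OnePoint ℂ → ℝ} (hf : ContinuousOn f (sphereBoundary (openAngle α β))) {h : ℝ →ᵇ ℝ}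
    (hh : ∀ s : ℝ, h s = f (angleParam α β s)) {ζ : OnePoint ℂ}
    (hζ : ζ ∈ sphereBoundary (openAngle α β)) :
    Tendsto (fun z => ∫ s, h s ∂halfPlaneMeasure (angleReduction α β z))
      (nhdsIn (openAngle α β) ζ) (𝓝 (f ζ)) := by
  induction ζ using OnePoint.rec with
  | infty =>
    have hlim : Tendsto h (cocompact ℝ) (𝓝 (f OnePoint.infty)) := by
      rw [funext hh]
      exact (hf _ hζ).tendsto.comp (tendsto_nhdsWithin_iff.2
        ⟨tendsto_angleParam_ofReal_infty hαβ,
          Eventually.of_forall (coe_angleParam_ofReal_mem hαβ hβ)⟩)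
    exact (tendsto_integral_of_tendsto_cocompact
      (fun K hK => tendsto_halfPlaneMeasure_isCompact hK) h hlim).comp
      (tendsto_angleReduction_infty hαβ hβ)
  | coe c =>
    have hc : c ∉ openAngle α β := fun hc => hζ.2 <| by
      rw [(OnePoint.isOpenEmbedding_coe.isOpenMap _ (isOpen_openAngle α β)).interior_eq]
      exact mem_image_of_mem _ hc
    rw [nhdsIn_coe, tendsto_iff_ultrafilter]
    intro 𝒰 h𝒰
    obtain ⟨s, rfl, hs⟩ := exists_tendsto_angleReduction hαβ hβ hc h𝒰
    simpa [Function.comp_def, halfPlaneMeasure_ofReal, hh] using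
      ((continuous_integral_halfPlaneMeasure h).tendsto s).comp hs

/-- The harmonic measure of `∠(α, β)` at `z`: the image under the boundary parametrization of the
harmonic measure of the upper half-plane at `angleReduction α β z`. -/
def angleMeasure (α β : ℝ) (z : ℂ) : Measure ℂ :=
  (halfPlaneMeasure (angleReduction α β z)).map fun s : ℝ => angleParam α β s

theorem isProbabilityMeasure_angleMeasure (hαβ : α < β) (z : ℂ) :
    IsProbabilityMeasure (angleMeasure α β z) :=
  Measure.isProbabilityMeasure_map (continuous_angleParam_ofReal hαβ).aemeasurable

theorem isHarmonicMeasure_openAngle (hαβ : α < β) (hβ : β ≤ α + 2 * π) (hz : z ∈ openAngle α β) :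
    IsHarmonicMeasure (openAngle α β) z
      ((angleMeasure α β z).map fun z : ℂ => (z : OnePoint ℂ)) := by
  set γ : ℝ → OnePoint ℂ := fun s => (angleParam α β s : OnePoint ℂ)
  have hγ : Continuous γ := OnePoint.continuous_coe.comp (continuous_angleParam_ofReal hαβ)
  have hγ_mem : ∀ s, γ s ∈ sphereBoundary (openAngle α β) := coe_angleParam_ofReal_mem hαβ hβ
  have hclosed : IsClosed (sphereBoundary (openAngle α β)) := isClosed_frontier
  have hmap : (angleMeasure α β z).map (fun z : ℂ => (z : OnePoint ℂ))
      = (halfPlaneMeasure (angleReduction α β z)).map γ :=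
    Measure.map_map OnePoint.continuous_coe.measurable
      (continuous_angleParam_ofReal hαβ).measurable
  have hnull : (halfPlaneMeasure (angleReduction α β z)).map γ
      (sphereBoundary (openAngle α β))ᶜ = 0 := by
    rw [Measure.map_apply hγ.measurable hclosed.measurableSet.compl,
      preimage_eq_empty (disjoint_left.2 fun ζ hζ ⟨s, hs⟩ => hζ (hs ▸ hγ_mem s)), measure_empty]
  rw [hmap]
  refine isHarmonicMeasure_of_forall_solution (isOpen_openAngle α β) hz hnull fun f hf => ?_
  obtain ⟨M, hM⟩ := hclosed.isCompact.exists_bound_of_continuousOn hf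
  let h : ℝ →ᵇ ℝ := .ofNormedAddCommGroup (f ∘ γ) (hf.comp_continuous hγ hγ_mem) M
    fun s => hM _ (hγ_mem s)
  refine ⟨_, hasMeanValueOn_integral_halfPlaneMeasure (differentiableOn_angleReduction hβ)
    (fun z => angleReduction_im_pos hβ) h,
    fun ζ => tendsto_integral_angleReduction hαβ hβ hf fun s => rfl, ?_⟩
  have hmeas := hf.aestronglyMeasurable (μ := (halfPlaneMeasure (angleReduction α β z)).map γ)
    hclosed.measurableSet
  rw [Measure.restrict_eq_self_of_ae_mem (s := sphereBoundary _) (mem_ae_iff.2 hnull)] at hmeas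
  exact (integral_map hγ.aemeasurable hmeas).symm

theorem harmonicMeasure_openAngle (hαβ : α < β) (hβ : β ≤ α + 2 * π) (hz : z ∈ openAngle α β) :
    harmonicMeasure (openAngle α β) z
      = (angleMeasure α β z).map fun z : ℂ => (z : OnePoint ℂ) :=
  (isHarmonicMeasure_openAngle hαβ hβ hz).harmonicMeasure_eq

end Angle

/-! ### The components of the complement of a system of rays -/

section Components

variable {S : Set ℂ} {α β p : ℝ} {z : ℂ}

theorem exists_gap_of_isClosed_of_periodic {T : Set ℝ} (hT : IsClosed T) (hne : T.Nonempty)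
    {c : ℝ} (hc : 0 < c) (hper : Function.Periodic (· ∈ T) c) {θ₀ : ℝ} (hθ₀ : θ₀ ∉ T) :
    ∃ α ∈ T, ∃ β ∈ T, θ₀ ∈ Ioo α β ∧ β ≤ α + c ∧ Disjoint (Ioo α β) T := by
  obtain ⟨θ, hθ⟩ := hne
  have hex : ∀ a, ∃ b ∈ T, b ∈ Ico a (a + c) := fun a => by
    obtain ⟨b, hb, hbθ⟩ := hper.exists_mem_Ico hc θ a
    exact ⟨b, hbθ.mp hθ, hb⟩
  have hbelow : BddAbove (T ∩ Iic θ₀) := ⟨θ₀, fun x hx => hx.2⟩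
  have habove : BddBelow (T ∩ Ici θ₀) := ⟨θ₀, fun x hx => hx.2⟩
  obtain ⟨hα, hαθ₀⟩ : sSup (T ∩ Iic θ₀) ∈ T ∩ Iic θ₀ := by
    obtain ⟨b, hb, hbθ₀⟩ := hex (θ₀ - c)
    exact (hT.inter isClosed_Iic).csSup_mem ⟨b, hb, by simpa using hbθ₀.2.le⟩ hbelow
  obtain ⟨hβ, hβθ₀⟩ : sInf (T ∩ Ici θ₀) ∈ T ∩ Ici θ₀ := by
    obtain ⟨b, hb, hbθ₀⟩ := hex θ₀
    exact (hT.inter isClosed_Ici).csInf_mem ⟨b, hb, hbθ₀.1⟩ habove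
  refine ⟨_, hα, _, hβ, ⟨lt_of_le_of_ne hαθ₀ fun h => hθ₀ (h ▸ hα),
    lt_of_le_of_ne' hβθ₀ fun h => hθ₀ (h ▸ hβ)⟩, ?_, disjoint_left.2 fun θ hθ hθT => ?_⟩
  · have hshift : sSup (T ∩ Iic θ₀) + c ∈ T := (hper _).mpr hα
    refine csInf_le habove ⟨hshift, mem_Ici.2 <| le_of_not_gt fun h => ?_⟩
    linarith [le_csSup hbelow ⟨hshift, h.le⟩]
  · rcases le_total θ θ₀ with h | h
    · exact hθ.1.not_ge (le_csSup hbelow ⟨hθT, h⟩)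
    · exact hθ.2.not_ge (csInf_le habove ⟨hθT, h⟩)

theorem IsClosedRaySystem.circleMap_mem (hS : IsClosedRaySystem S) {r s θ : ℝ} (hr : 0 < r)
    (hs : 0 ≤ s) (h : circleMap 0 r θ ∈ S) : circleMap 0 s θ ∈ S := by
  obtain ⟨-, Θ, -, rfl⟩ := hS
  simp only [mem_iUnion, exists_prop] at h ⊢
  obtain ⟨u, hu, t, ht, htu⟩ := h
  refine ⟨u, hu, s / r * t, by positivity, ?_⟩
  have hscale : circleMap 0 s θ = (s / r : ℝ) * circleMap 0 r θ := by
    rw [circleMap_zero, circleMap_zero, ← mul_assoc, ← Complex.ofReal_mul,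
      div_mul_cancel₀ _ hr.ne']
  rw [hscale, htu]
  push_cast; ring

theorem IsClosedRaySystem.zero_mem (hS : IsClosedRaySystem S) : (0 : ℂ) ∈ S := by
  obtain ⟨-, Θ, ⟨u, hu⟩, rfl⟩ := hS
  exact mem_biUnion hu ⟨0, le_rfl, by simp⟩

theorem IsClosedRaySystem.exists_circleMap_mem (hS : IsClosedRaySystem S) :
    ∃ θ, circleMap 0 1 θ ∈ S := by
  obtain ⟨-, Θ, ⟨u, hu⟩, rfl⟩ := hS
  refine ⟨Complex.arg u, mem_biUnion hu ⟨1, zero_le_one, ?_⟩⟩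
  have hpolar := Complex.norm_mul_exp_arg_mul_I (u : ℂ)
  rw [Circle.norm_coe] at hpolar
  rw [circleMap_zero, hpolar, Complex.ofReal_one, one_mul]

theorem openAngle_eq_connectedComponentIn (hαβ : α < β) (hβ : β ≤ α + 2 * π)
    (hsub : openAngle α β ⊆ Sᶜ) (hS : ∀ s : ℝ, angleParam α β s ∈ S) (hz : z ∈ openAngle α β) :
    openAngle α β = connectedComponentIn Sᶜ z := by
  refine ((isPreconnected_openAngle α β).subset_connectedComponentIn hz hsub).antisymm
    (isPreconnected_connectedComponentIn.subset_of_closure_inter_subset (isOpen_openAngle α β)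
      ⟨z, mem_connectedComponentIn (hsub hz), hz⟩ ?_)
  rintro w ⟨hw, hwz⟩
  rcases closure_openAngle_subset hαβ hβ hw with h | ⟨s, rfl⟩
  · exact h
  · exact absurd (hS s) (connectedComponentIn_subset _ _ hwz)

theorem IsClosedRaySystem.exists_isComplementaryAngle (hS : IsClosedRaySystem S) (hz : z ∉ S) :
    ∃ α β, IsComplementaryAngle S α β ∧ z ∈ openAngle α β := by
  have hz₀ : 0 < ‖z‖ := norm_pos_iff.2 fun h => hz (h ▸ hS.zero_mem)
  have hpolar : circleMap 0 ‖z‖ z.arg = z := by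
    rw [circleMap_zero, Complex.norm_mul_exp_arg_mul_I]
  obtain ⟨α, hα, β, hβ, hzαβ, hαβ, hdisj⟩ := exists_gap_of_isClosed_of_periodic
    (T := circleMap 0 1 ⁻¹' S) (hS.1.preimage (continuous_circleMap 0 1))
    hS.exists_circleMap_mem Real.two_pi_pos
    (fun θ => by simp only [mem_preimage, periodic_circleMap 0 1 θ])
    fun h => hz (hpolar ▸ hS.circleMap_mem one_pos hz₀.le h)
  have hlt : α < β := hzαβ.1.trans hzαβ.2
  have hzA : z ∈ openAngle α β := ⟨_, _, hz₀, hzαβ.1, hzαβ.2, by rw [← circleMap_zero, hpolar]⟩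
  have hsub : openAngle α β ⊆ Sᶜ := by
    rintro _ ⟨r, θ, hr, hαθ, hθβ, rfl⟩ hmem
    rw [← circleMap_zero] at hmem
    exact disjoint_left.1 hdisj ⟨hαθ, hθβ⟩ (hS.circleMap_mem hr zero_le_one hmem)
  have hboundary : ∀ s : ℝ, angleParam α β s ∈ S := fun s => by
    rcases le_total 0 s with hs | hs
    · rw [angleParam_ofReal_of_nonneg _ _ hs]
      exact hS.circleMap_mem one_pos (by positivity) hα
    · rw [angleParam_ofReal_of_nonpos _ _ hs]
      exact hS.circleMap_mem one_pos (Real.rpow_nonneg (neg_nonneg.2 hs) _) hβ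
  exact ⟨α, β, ⟨hlt, hαβ, z, hz, openAngle_eq_connectedComponentIn hlt hαβ hsub hboundary hzA⟩, hzA⟩

theorem IsComplementaryAngle.subset_compl (h : IsComplementaryAngle S α β) :
    openAngle α β ⊆ Sᶜ := by
  obtain ⟨-, -, z, -, hz⟩ := h
  exact hz ▸ connectedComponentIn_subset _ _

theorem IsComplementaryAngle.connectedComponentIn_eq (h : IsComplementaryAngle S α β)
    (hz : z ∈ openAngle α β) : connectedComponentIn Sᶜ z = openAngle α β := by
  obtain ⟨-, -, w, -, hw⟩ := h
  rw [hw] at hz ⊢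
  exact (_root_.connectedComponentIn_eq hz).symm

/-- The set of angles complementary to `S`. -/
def complementaryAngles (S : Set ℂ) : Set (Set ℂ) :=
  {A | ∃ α β : ℝ, IsComplementaryAngle S α β ∧ A = openAngle α β}

theorem isOpen_of_mem_complementaryAngles {A : Set ℂ} (hA : A ∈ complementaryAngles S) :
    IsOpen A := by
  obtain ⟨α, β, -, rfl⟩ := hA
  exact isOpen_openAngle α β

theorem pairwiseDisjoint_complementaryAngles (S : Set ℂ) :
    (complementaryAngles S).PairwiseDisjoint id := by
  rintro A ⟨α, β, h, rfl⟩ B ⟨α', β', h', rfl⟩ hne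
  refine disjoint_left.2 fun z hz hz' => hne ?_
  rw [← h.connectedComponentIn_eq hz, ← h'.connectedComponentIn_eq hz']

theorem countable_complementaryAngles (S : Set ℂ) : (complementaryAngles S).Countable := by
  refine (pairwiseDisjoint_complementaryAngles S).countable_of_isOpen
    (fun A => isOpen_of_mem_complementaryAngles) ?_
  rintro A ⟨α, β, ⟨-, -, z, hz, h⟩, rfl⟩
  exact ⟨z, h ▸ mem_connectedComponentIn hz⟩

/-! ### Counting wide angles -/

/-- The measure of the set of directions of the points of a plane set on the unit circle. -/
def angularMeasure : Measure ℂ := (volume.restrict (Ioc 0 (2 * π))).map (circleMap 0 1)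

theorem angularMeasure_univ : angularMeasure univ = ENNReal.ofReal (2 * π) := by
  simp [angularMeasure, Measure.map_apply (continuous_circleMap 0 1).measurable]

theorem angularMeasure_openAngle (hβ : β ≤ α + 2 * π) :
    angularMeasure (openAngle α β) = ENNReal.ofReal (β - α) := by
  have hA : MeasurableSet (circleMap 0 1 ⁻¹' openAngle α β) :=
    (isOpen_openAngle α β).measurableSet.preimage (continuous_circleMap 0 1).measurable
  have hinter : circleMap 0 1 ⁻¹' openAngle α β ∩ Ioc α (α + 2 * π) = Ioo α β := by
    ext θ
    refine ⟨fun h => ?_, fun h => ?_⟩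
    · exact ((circleMap_mem_openAngle_iff hβ zero_le_one (Ioc_subset_Icc_self h.2)).1 h.1).2
    · have hθ : θ ∈ Ioc α (α + 2 * π) := ⟨h.1, h.2.le.trans hβ⟩
      exact ⟨(circleMap_mem_openAngle_iff hβ zero_le_one (Ioc_subset_Icc_self hθ)).2
        ⟨one_pos, h⟩, hθ⟩
  rw [angularMeasure, Measure.map_apply (continuous_circleMap 0 1).measurable
    (isOpen_openAngle α β).measurableSet, Measure.restrict_apply hA, ← Real.volume_Ioo, ← hinter]
  have h0 := isAddFundamentalDomain_Ioc Real.two_pi_pos 0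
  rw [zero_add] at h0
  refine h0.measure_set_eq (isAddFundamentalDomain_Ioc Real.two_pi_pos α) hA ?_
  rintro ⟨_, n, rfl⟩
  ext θ
  change circleMap 0 1 (n • (2 * π) + θ) ∈ openAngle α β ↔ circleMap 0 1 θ ∈ openAngle α β
  rw [add_comm, (periodic_circleMap 0 1).zsmul n θ]

theorem encard_mul_le_measure_univ {X : Type*} [MeasurableSpace X] {μ : Measure X}
    {𝒜 : Set (Set X)} (hmeas : ∀ A ∈ 𝒜, MeasurableSet A) (hdisj : 𝒜.PairwiseDisjoint id)
    {c : ℝ≥0∞} (hc : ∀ A ∈ 𝒜, c ≤ μ A) : 𝒜.encard * c ≤ μ univ :=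
  calc (𝒜.encard : ℝ≥0∞) * c = ∑' _ : 𝒜, c := (ENNReal.tsum_set_const 𝒜 c).symm
    _ ≤ ∑' A : 𝒜, μ A := ENNReal.tsum_le_tsum fun A => hc A A.2
    _ ≤ μ univ := tsum_measure_le_measure_univ (fun A => (hmeas A A.2).nullMeasurableSet)
        fun A B hAB => (hdisj A.2 B.2 (Subtype.coe_injective.ne hAB)).aedisjoint

/-- The complementary angles of opening at least `π / p`, none for `p = 0`. -/
def wideAngles (S : Set ℂ) (p : ℝ) : Set (Set ℂ) :=
  {A | ∃ α β : ℝ, IsComplementaryAngle S α β ∧ π ≤ p * (β - α) ∧ A = openAngle α β}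

theorem wideAngles_subset (S : Set ℂ) (p : ℝ) : wideAngles S p ⊆ complementaryAngles S := by
  rintro A ⟨α, β, h, -, rfl⟩
  exact ⟨α, β, h, rfl⟩

theorem encard_wideAngles_le (S : Set ℂ) (p : ℝ) :
    ((wideAngles S p).encard : ℝ≥0∞) ≤ ENNReal.ofReal (2 * p) := by
  have hle := encard_mul_le_measure_univ (μ := ENNReal.ofReal p • angularMeasure)
    (𝒜 := wideAngles S p) (c := ENNReal.ofReal π)
    (fun A hA => (isOpen_of_mem_complementaryAngles (wideAngles_subset S p hA)).measurableSet)
    ((pairwiseDisjoint_complementaryAngles S).subset (wideAngles_subset S p)) <| by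
      rintro _ ⟨α, β, h, hπ, rfl⟩
      rw [Measure.smul_apply, angularMeasure_openAngle h.2.1, smul_eq_mul,
        ← ENNReal.ofReal_mul' (sub_nonneg.2 h.1.le)]
      exact ENNReal.ofReal_le_ofReal hπ
  rw [Measure.smul_apply, angularMeasure_univ, smul_eq_mul,
    ← ENNReal.ofReal_mul' Real.two_pi_pos.le,
    show p * (2 * π) = 2 * p * π by ring, ENNReal.ofReal_mul' Real.pi_pos.le] at hle
  exact (ENNReal.mul_le_mul_iff_left (ENNReal.ofReal_pos.2 Real.pi_pos).ne'
    ENNReal.ofReal_ne_top).1 hle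

theorem finite_wideAngles (S : Set ℂ) (p : ℝ) : (wideAngles S p).Finite := by
  have := (encard_wideAngles_le S p).trans_lt ENNReal.ofReal_lt_top
  rw [← encard_ne_top_iff]
  rintro h
  simp [h] at this

theorem ncard_wideAngles_le (S : Set ℂ) (hp : 0 ≤ p) : ((wideAngles S p).ncard : ℝ) ≤ 2 * p := by
  have h := encard_wideAngles_le S p
  rw [← (finite_wideAngles S p).cast_ncard_eq] at h
  simpa using ENNReal.toReal_le_of_le_ofReal (by positivity) h

end Components

/-! ### Growth of finite order -/

section Growth

variable {p q : ℝ} {f g : ℝ → ℝ≥0∞}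

/-- `f r = O(r ^ p)` as `r → ∞`, for functions with values in `[0, ∞]`; the constant is
required to be finite. -/
def HasGrowthAtMost (p : ℝ) (f : ℝ → ℝ≥0∞) : Prop :=
  ∃ C ≠ ⊤, ∀ᶠ r in atTop, f r ≤ C * ENNReal.ofReal (r ^ p)

theorem hasGrowthAtMost_zero (p : ℝ) : HasGrowthAtMost p 0 :=
  ⟨0, ENNReal.zero_ne_top, .of_forall fun _ => zero_le⟩

theorem HasGrowthAtMost.mono (hg : HasGrowthAtMost p g) (hfg : ∀ᶠ r in atTop, f r ≤ g r) :
    HasGrowthAtMost p f := by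
  obtain ⟨C, hC, h⟩ := hg
  exact ⟨C, hC, by filter_upwards [hfg, h] with r hfgr hgr using hfgr.trans hgr⟩

theorem HasGrowthAtMost.add (hf : HasGrowthAtMost p f) (hg : HasGrowthAtMost p g) :
    HasGrowthAtMost p fun r => f r + g r := by
  obtain ⟨C, hC, hf⟩ := hf
  obtain ⟨C', hC', hg⟩ := hg
  refine ⟨C + C', ENNReal.add_ne_top.2 ⟨hC, hC'⟩, ?_⟩
  filter_upwards [hf, hg] with r hfr hgr
  exact (add_le_add hfr hgr).trans_eq (add_mul _ _ _).symm

theorem HasGrowthAtMost.const_mul (hf : HasGrowthAtMost p f) {c : ℝ≥0∞} (hc : c ≠ ⊤) :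
    HasGrowthAtMost p fun r => c * f r := by
  obtain ⟨C, hC, hf⟩ := hf
  refine ⟨c * C, ENNReal.mul_ne_top hc hC, ?_⟩
  filter_upwards [hf] with r hr
  rw [mul_assoc]
  gcongr

theorem HasGrowthAtMost.comp_const_mul (hf : HasGrowthAtMost p f) {c : ℝ} (hc : 0 < c) :
    HasGrowthAtMost p fun r => f (c * r) := by
  obtain ⟨C, hC, hf⟩ := hf
  refine ⟨C * ENNReal.ofReal (c ^ p), ENNReal.mul_ne_top hC ENNReal.ofReal_ne_top, ?_⟩
  filter_upwards [(tendsto_id.const_mul_atTop hc).eventually hf, eventually_ge_atTop 0] with r hr h0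
  rwa [id, Real.mul_rpow hc.le h0, ENNReal.ofReal_mul (by positivity), ← mul_assoc] at hr

theorem HasGrowthAtMost.setLIntegral_biUnion {X ι : Type*} [MeasurableSpace X] {ν : Measure X}
    {F : Set ι} (hF : F.Finite) {s : ι → ℝ → Set X} {φ : ℝ → X → ℝ≥0∞}
    (h : ∀ i ∈ F, HasGrowthAtMost p fun r => ∫⁻ x in s i r, φ r x ∂ν) :
    HasGrowthAtMost p fun r => ∫⁻ x in ⋃ i ∈ F, s i r, φ r x ∂ν := by
  induction F, hF using Set.Finite.induction_on with
  | empty => simpa using! hasGrowthAtMost_zero p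
  | insert _ _ ih =>
    refine ((h _ (mem_insert _ _)).add (ih fun i hi => h i (mem_insert_of_mem _ hi))).mono
      (.of_forall fun r => ?_)
    rw [biUnion_insert]
    exact lintegral_union_le _ _ _

theorem typeAtInfty_lt_top_iff {ν : Measure ℂ} :
    typeAtInfty p ν < ⊤ ↔ HasGrowthAtMost p fun r => ν (closedBall 0 r) := by
  constructor
  · intro h
    obtain ⟨C, hC, hCtop⟩ := exists_between h
    refine ⟨C, hCtop.ne, ?_⟩
    filter_upwards [eventually_lt_of_limsup_lt hC, eventually_gt_atTop 0] with r hr hr₀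
    exact (ENNReal.div_le_iff (ENNReal.ofReal_pos.2 (Real.rpow_pos_of_pos hr₀ p)).ne'
      ENNReal.ofReal_ne_top).1 hr.le
  · rintro ⟨C, hC, h⟩
    refine (limsup_le_of_le (by isBoundedDefault) ?_).trans_lt hC.lt_top
    exact h.mono fun r hr => ENNReal.div_le_of_le_mul hr

section Tail

variable {E : Type*} [SeminormedAddCommGroup E]

theorem div_norm_rpow_le_tsum_dyadic (hq : 0 ≤ q) {r : ℝ} (hr : 0 < r) {z : E} (hz : r < ‖z‖) :
    ENNReal.ofReal ((r / ‖z‖) ^ q) ≤ ∑' k : ℕ, (closedBall (0 : E) (2 ^ (k + 1) * r)).indicator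
      (fun _ => ENNReal.ofReal (((2 : ℝ) ^ k)⁻¹ ^ q)) z := by
  obtain ⟨k, hk, hk'⟩ := exists_nat_pow_near ((one_le_div hr).2 hz.le) one_lt_two
  rw [div_lt_iff₀ hr] at hk'
  refine le_trans ?_ (ENNReal.le_tsum k)
  rw [indicator_of_mem (mem_closedBall_zero_iff.2 hk'.le), ← inv_div]
  gcongr

variable [MeasurableSpace E] [OpensMeasurableSpace E] {ν : Measure E}

theorem setLIntegral_div_norm_rpow_le_tsum (ν : Measure E) (hq : 0 ≤ q) {r : ℝ} (hr : 0 < r) :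
    ∫⁻ z in (closedBall 0 r)ᶜ, ENNReal.ofReal ((r / ‖z‖) ^ q) ∂ν
      ≤ ∑' k : ℕ, ENNReal.ofReal (((2 : ℝ) ^ k)⁻¹ ^ q) * ν (closedBall 0 (2 ^ (k + 1) * r)) :=
  calc ∫⁻ z in (closedBall 0 r)ᶜ, ENNReal.ofReal ((r / ‖z‖) ^ q) ∂ν
      ≤ ∫⁻ z in (closedBall 0 r)ᶜ, ∑' k : ℕ, (closedBall (0 : E) (2 ^ (k + 1) * r)).indicator
          (fun _ => ENNReal.ofReal (((2 : ℝ) ^ k)⁻¹ ^ q)) z ∂ν :=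
        setLIntegral_mono' isClosed_closedBall.measurableSet.compl fun z hz =>
          div_norm_rpow_le_tsum_dyadic hq hr (by simpa using hz)
    _ ≤ ∫⁻ z, ∑' k : ℕ, (closedBall (0 : E) (2 ^ (k + 1) * r)).indicator
          (fun _ => ENNReal.ofReal (((2 : ℝ) ^ k)⁻¹ ^ q)) z ∂ν := setLIntegral_le_lintegral _ _
    _ = ∑' k : ℕ, ENNReal.ofReal (((2 : ℝ) ^ k)⁻¹ ^ q) * ν (closedBall 0 (2 ^ (k + 1) * r)) := by
        rw [lintegral_tsum fun k => (measurable_const.indicator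
          isClosed_closedBall.measurableSet).aemeasurable]
        simp only [lintegral_indicator_const isClosed_closedBall.measurableSet]

theorem dyadic_rpow_mul_rpow (p q : ℝ) {r : ℝ} (hr : 0 ≤ r) (k : ℕ) :
    ((2 : ℝ) ^ k)⁻¹ ^ q * (2 ^ (k + 1) * r) ^ p = 2 ^ p * r ^ p * (2 ^ (p - q)) ^ k := by
  rw [Real.mul_rpow (by positivity) hr, pow_succ, Real.mul_rpow (by positivity) zero_le_two,
    Real.rpow_sub two_pos, div_pow, Real.inv_rpow (by positivity), ← Real.rpow_pow_comm zero_le_two,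
    ← Real.rpow_pow_comm zero_le_two]
  field_simp

theorem HasGrowthAtMost.lintegral_tail (hq : 0 ≤ q) (hpq : p < q)
    (hν : HasGrowthAtMost p fun r => ν (closedBall (0 : E) r)) :
    HasGrowthAtMost p fun r => ∫⁻ z in (closedBall 0 r)ᶜ, ENNReal.ofReal ((r / ‖z‖) ^ q) ∂ν := by
  obtain ⟨C, hC, hν⟩ := hν
  set x := ENNReal.ofReal (2 ^ (p - q)) with hx
  have hx₁ : x < 1 := ENNReal.ofReal_lt_one.2 <|
    Real.rpow_lt_one_of_one_lt_of_neg one_lt_two (sub_neg.2 hpq)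
  refine ⟨C * ENNReal.ofReal (2 ^ p) * (1 - x)⁻¹, ENNReal.mul_ne_top
    (ENNReal.mul_ne_top hC ENNReal.ofReal_ne_top)
    (ENNReal.inv_ne_top.2 (tsub_pos_of_lt hx₁).ne'), ?_⟩
  filter_upwards [eventually_forall_ge_atTop.2 hν, eventually_gt_atTop 0] with r hr hr₀
  calc ∫⁻ z in (closedBall 0 r)ᶜ, ENNReal.ofReal ((r / ‖z‖) ^ q) ∂ν
      ≤ ∑' k : ℕ, ENNReal.ofReal (((2 : ℝ) ^ k)⁻¹ ^ q) * ν (closedBall 0 (2 ^ (k + 1) * r)) :=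
        setLIntegral_div_norm_rpow_le_tsum ν hq hr₀
    _ ≤ ∑' k : ℕ, ENNReal.ofReal (((2 : ℝ) ^ k)⁻¹ ^ q) *
          (C * ENNReal.ofReal ((2 ^ (k + 1) * r) ^ p)) :=
        ENNReal.tsum_le_tsum fun k => mul_le_mul_right
          (hr _ (le_mul_of_one_le_left hr₀.le (one_le_pow₀ one_le_two))) _
    _ = ∑' k : ℕ, C * (ENNReal.ofReal (2 ^ p) * ENNReal.ofReal (r ^ p)) * x ^ k := by
        congr 1 with k
        rw [mul_left_comm, ← ENNReal.ofReal_mul (by positivity), dyadic_rpow_mul_rpow p q hr₀.le,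
          ENNReal.ofReal_mul (by positivity), ENNReal.ofReal_mul (by positivity),
          ENNReal.ofReal_pow (by positivity), ← mul_assoc, hx]
    _ = C * ENNReal.ofReal (2 ^ p) * (1 - x)⁻¹ * ENNReal.ofReal (r ^ p) := by
        rw [ENNReal.tsum_mul_left, ENNReal.tsum_geometric]
        ring

end Tail

end Growth

/-! ### Harmonic measure of discs -/

section Disc

variable {α β r q : ℝ} {z : ℂ}

theorem preimage_angleParam_closedBall (hαβ : α < β) (hr : 0 ≤ r) :
    (fun s : ℝ => angleParam α β s) ⁻¹' closedBall 0 r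
      = Icc (-r ^ angleExponent α β) (r ^ angleExponent α β) := by
  ext s
  rw [mem_preimage, mem_closedBall_zero_iff, norm_angleParam, Complex.norm_real, Real.norm_eq_abs,
    Real.rpow_inv_le_iff_of_pos (abs_nonneg s) hr (angleExponent_pos hαβ), abs_le, mem_Icc]

theorem preimage_angleParam_ball (hαβ : α < β) (hr : 0 ≤ r) :
    (fun s : ℝ => angleParam α β s) ⁻¹' ball 0 r
      = Ioo (-r ^ angleExponent α β) (r ^ angleExponent α β) := by
  ext s
  rw [mem_preimage, mem_ball_zero_iff, norm_angleParam, Complex.norm_real, Real.norm_eq_abs,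
    Real.rpow_inv_lt_iff_of_pos (abs_nonneg s) hr (angleExponent_pos hαβ), abs_lt, mem_Ioo]

theorem angleMeasure_closedBall_le (hαβ : α < β) (hβ : β ≤ α + 2 * π) (hz : z ∈ openAngle α β)
    (hr : 0 ≤ r) (hzr : 4 * r ≤ ‖z‖) :
    angleMeasure α β z (closedBall 0 r) ≤
      ENNReal.ofReal (8 / π * r ^ angleExponent α β * -(1 / angleReduction α β z).im) := by
  rw [angleMeasure, Measure.map_apply (continuous_angleParam_ofReal hαβ).measurable
    isClosed_closedBall.measurableSet, preimage_angleParam_closedBall hαβ hr]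
  refine halfPlaneMeasure_Icc_le (angleReduction_im_pos hβ hz) (by positivity) ?_
  -- Since the exponent is at least `1 / 2`, a ratio `4` in the angle becomes at least `2`.
  have two_le : (2 : ℝ) ≤ 4 ^ angleExponent α β := by
    calc (2 : ℝ) = 4 ^ (1 / 2 : ℝ) := by
          rw [← Real.sqrt_eq_rpow, show (4 : ℝ) = 2 ^ 2 by norm_num, Real.sqrt_sq zero_le_two]
      _ ≤ 4 ^ angleExponent α β :=
          Real.rpow_le_rpow_of_exponent_le (by norm_num) (half_le_angleExponent hαβ hβ)
  calc 2 * r ^ angleExponent α β ≤ 4 ^ angleExponent α β * r ^ angleExponent α β := by gcongr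
    _ = (4 * r) ^ angleExponent α β := (Real.mul_rpow (by norm_num) hr).symm
    _ ≤ ‖z‖ ^ angleExponent α β := by gcongr; exact (angleExponent_pos hαβ).le
    _ = ‖angleReduction α β z‖ := (norm_angleReduction hβ hz).symm

theorem neg_one_div_angleReduction_im_le (hβ : β ≤ α + 2 * π) (hz : z ∈ openAngle α β) :
    -(1 / angleReduction α β z).im ≤ (‖z‖ ^ angleExponent α β)⁻¹ :=
  calc -(1 / angleReduction α β z).im ≤ ‖1 / angleReduction α β z‖ :=
        (neg_le_abs _).trans (Complex.abs_im_le_norm _)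
    _ = (‖z‖ ^ angleExponent α β)⁻¹ := by
        rw [norm_div, norm_one, one_div, norm_angleReduction hβ hz]

theorem angleMeasure_closedBall_le_rpow (hαβ : α < β) (hβ : β ≤ α + 2 * π)
    (hz : z ∈ openAngle α β) (hr : 0 < r) (hzr : 4 * r ≤ ‖z‖) (hq : q ≤ angleExponent α β) :
    angleMeasure α β z (closedBall 0 r) ≤
      ENNReal.ofReal (8 / π) * ENNReal.ofReal ((r / ‖z‖) ^ q) := by
  have hz₀ : 0 < ‖z‖ := by linarith
  rw [← ENNReal.ofReal_mul (by positivity)]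
  refine (angleMeasure_closedBall_le hαβ hβ hz hr.le hzr).trans (ENNReal.ofReal_le_ofReal ?_)
  calc 8 / π * r ^ angleExponent α β * -(1 / angleReduction α β z).im
      ≤ 8 / π * r ^ angleExponent α β * (‖z‖ ^ angleExponent α β)⁻¹ := by
        gcongr
        exact neg_one_div_angleReduction_im_le hβ hz
    _ = 8 / π * (r / ‖z‖) ^ angleExponent α β := by
        rw [Real.div_rpow hr.le hz₀.le, mul_assoc, div_eq_mul_inv _ (‖z‖ ^ _)]
    _ ≤ 8 / π * (r / ‖z‖) ^ q :=
        mul_le_mul_of_nonneg_left (Real.rpow_le_rpow_of_exponent_ge (by positivity)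
          ((div_le_one hz₀).2 (by linarith)) hq) (by positivity)

theorem le_angleMeasure_ball (hαβ : α < β) (hβ : β ≤ α + 2 * π) (hz : z ∈ openAngle α β)
    (hr : 0 ≤ r) (hzr : r ≤ ‖z‖) :
    ENNReal.ofReal (r ^ angleExponent α β / (2 * π) * -(1 / angleReduction α β z).im)
      ≤ angleMeasure α β z (ball 0 r) := by
  rw [angleMeasure, Measure.map_apply (continuous_angleParam_ofReal hαβ).measurable
    isOpen_ball.measurableSet, preimage_angleParam_ball hαβ hr]
  refine le_halfPlaneMeasure_Ioo (angleReduction_im_pos hβ hz) (by positivity) ?_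
  rw [norm_angleReduction hβ hz]
  exact Real.rpow_le_rpow hr hzr (angleExponent_pos hαβ).le

theorem measurable_angleReduction (α β : ℝ) : Measurable (angleReduction α β) := by
  unfold angleReduction
  fun_prop

theorem measurable_angleMeasure (hαβ : α < β) : Measurable (angleMeasure α β) := by
  refine Measure.measurable_of_measurable_coe _ fun B hB => ?_
  have hparam := (continuous_angleParam_ofReal hαβ).measurable
  simp only [angleMeasure, Measure.map_apply hparam hB]
  exact (measurable_halfPlaneMeasure_apply (hparam hB)).comp (measurable_angleReduction α β)

end Disc

/-! ### The balayage kernel -/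

section Kernel

variable {S : Set ℂ} {α β : ℝ} {z : ℂ}

open Classical in
/-- The measure `ω(z, ·; ℂ ∖ S)` on the plane. -/
def balayageKernel (S : Set ℂ) (z : ℂ) : Measure ℂ :=
  if z ∈ S then Measure.dirac z
  else (harmonicMeasure (connectedComponentIn Sᶜ z) z).comap fun w : ℂ => (w : OnePoint ℂ)

theorem omega_eq_balayageKernel (S : Set ℂ) (z : ℂ) (B : Set ℂ) :
    omega S z B = balayageKernel S z B := by
  unfold omega balayageKernel
  split_ifs
  · rfl
  · rw [OnePoint.isOpenEmbedding_coe.measurableEmbedding.comap_apply]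

theorem balayageKernel_of_mem (hz : z ∈ S) : balayageKernel S z = Measure.dirac z :=
  if_pos hz

theorem balayageKernel_of_mem_openAngle (h : IsComplementaryAngle S α β)
    (hz : z ∈ openAngle α β) : balayageKernel S z = angleMeasure α β z := by
  rw [balayageKernel, if_neg (h.subset_compl hz), h.connectedComponentIn_eq hz,
    harmonicMeasure_openAngle h.1 h.2.1 hz,
    OnePoint.isOpenEmbedding_coe.measurableEmbedding.comap_map]

theorem isProbabilityMeasure_balayageKernel (hS : IsClosedRaySystem S) (z : ℂ) :
    IsProbabilityMeasure (balayageKernel S z) := by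
  by_cases hz : z ∈ S
  · rw [balayageKernel_of_mem hz]
    infer_instance
  · obtain ⟨α, β, h, hzA⟩ := hS.exists_isComplementaryAngle hz
    rw [balayageKernel_of_mem_openAngle h hzA]
    exact isProbabilityMeasure_angleMeasure h.1 z

theorem sUnion_complementaryAngles (hS : IsClosedRaySystem S) : ⋃₀ complementaryAngles S = Sᶜ := by
  ext z
  refine ⟨?_, fun hz => ?_⟩
  · rintro ⟨_, ⟨α, β, h, rfl⟩, hz⟩
    exact h.subset_compl hz
  · obtain ⟨α, β, h, hzA⟩ := hS.exists_isComplementaryAngle hz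
    exact ⟨_, ⟨α, β, h, rfl⟩, hzA⟩

theorem measurable_of_countable_cover {X Y : Type*} [MeasurableSpace X] [MeasurableSpace Y]
    {f : X → Y} {𝒜 : Set (Set X)} (hcount : 𝒜.Countable) (hmeas : ∀ A ∈ 𝒜, MeasurableSet A)
    (hcover : ⋃₀ 𝒜 = univ) (hf : ∀ A ∈ 𝒜, ∃ g, Measurable g ∧ EqOn f g A) : Measurable f := by
  intro E hE
  rw [← inter_univ (f ⁻¹' E), ← hcover, sUnion_eq_biUnion, inter_iUnion₂]
  refine MeasurableSet.biUnion hcount fun A hA => ?_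
  obtain ⟨g, hg, hfg⟩ := hf A hA
  rw [inter_comm, hfg.inter_preimage_eq]
  exact (hmeas A hA).inter (hg hE)

theorem measurable_balayageKernel (hS : IsClosedRaySystem S) : Measurable (balayageKernel S) := by
  refine measurable_of_countable_cover ((countable_complementaryAngles S).insert S)
    (forall_mem_insert.2 ⟨hS.1.measurableSet, fun A hA =>
      (isOpen_of_mem_complementaryAngles hA).measurableSet⟩)
    (by rw [sUnion_insert, sUnion_complementaryAngles hS, union_compl_self])
    (forall_mem_insert.2 ⟨⟨_, Measure.measurable_dirac, fun z hz => balayageKernel_of_mem hz⟩, ?_⟩)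
  rintro _ ⟨α, β, h, rfl⟩
  exact ⟨_, measurable_angleMeasure h.1, fun z hz => balayageKernel_of_mem_openAngle h hz⟩

end Kernel

/-! ### The Blaschke condition and balayage -/

section Blaschke

variable {S : Set ℂ} {α β p : ℝ} {ν μ : Measure ℂ}

theorem blaschkeOutside_of_lintegral_omega_lt_top {r₀ : ℝ} (hr₀ : 0 < r₀)
    (h : ∫⁻ z, omega S z (ball 0 r₀) ∂ν < ⊤) : BlaschkeOutside ν S := by
  refine fun α β hA => ⟨r₀, hr₀, ?_⟩
  set c := r₀ ^ angleExponent α β / (2 * π)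
  have hc : 0 < c := by positivity
  have hle : ENNReal.ofReal c *
      ∫⁻ z in openAngle α β \ ball 0 r₀, ENNReal.ofReal (-(1 / angleReduction α β z).im) ∂ν
      ≤ ∫⁻ z, omega S z (ball 0 r₀) ∂ν := by
    rw [← lintegral_const_mul' _ _ ENNReal.ofReal_ne_top]
    refine (setLIntegral_mono' ((isOpen_openAngle α β).measurableSet.diff
      isOpen_ball.measurableSet) fun z hz => ?_).trans (setLIntegral_le_lintegral _ _)
    rw [← ENNReal.ofReal_mul hc.le, omega_eq_balayageKernel,
      balayageKernel_of_mem_openAngle hA hz.1]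
    exact le_angleMeasure_ball hA.1 hA.2.1 hz.1 hr₀.le (by simpa using hz.2)
  exact ENNReal.lt_top_of_mul_ne_top_right (hle.trans_lt h).ne (ENNReal.ofReal_pos.2 hc).ne'

theorem angleExponent_le_iff (hαβ : α < β) : angleExponent α β ≤ p ↔ π ≤ p * (β - α) := by
  rw [angleExponent, div_le_iff₀ (sub_pos.2 hαβ)]

theorem angleExponent_eq_div_angularMeasure (h : IsComplementaryAngle S α β) :
    angleExponent α β = π / (angularMeasure (openAngle α β)).toReal := by
  rw [angularMeasure_openAngle h.2.1, ENNReal.toReal_ofReal (sub_nonneg.2 h.1.le), angleExponent]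

-- Only finitely many complementary angles have exponent at most `p + 1`.
theorem exists_exponent_gap (S : Set ℂ) (p : ℝ) : ∃ q, p < q ∧ ∀ α β : ℝ,
    IsComplementaryAngle S α β → p < angleExponent α β → q ≤ angleExponent α β := by
  set exponents := (fun A => π / (angularMeasure A).toReal) '' wideAngles S (p + 1)
  have hfin : (insert (p + 1) (exponents ∩ Ioi p)).Finite :=
    (((finite_wideAngles S (p + 1)).image _).inter_of_left _).insert _
  obtain ⟨q, hq, hmin⟩ := exists_min_image _ id hfin (insert_nonempty _ _)
  refine ⟨q, ?_, fun α β h hlt => ?_⟩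
  · rcases hq with rfl | hq
    exacts [lt_add_one p, hq.2]
  · rcases le_total (angleExponent α β) (p + 1) with hle | hle
    · exact hmin _ <| .inr ⟨⟨_, ⟨α, β, h, (angleExponent_le_iff h.1).1 hle, rfl⟩,
        (angleExponent_eq_div_angularMeasure h).symm⟩, hlt⟩
    · exact (hmin _ (.inl rfl)).trans hle

theorem BlaschkeInAngle.hasGrowthAtMost (hB : BlaschkeInAngle ν α β)
    (h : IsComplementaryAngle S α β) (hp : angleExponent α β ≤ p) :
    HasGrowthAtMost p fun r =>
      ∫⁻ z in openAngle α β \ closedBall 0 (4 * r), balayageKernel S z (closedBall 0 r) ∂ν := by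
  obtain ⟨r₀, -, hfin⟩ := hB
  set I := ∫⁻ z in openAngle α β \ ball 0 r₀, ENNReal.ofReal (-(1 / angleReduction α β z).im) ∂ν
  refine ⟨ENNReal.ofReal (8 / π) * I, ENNReal.mul_ne_top ENNReal.ofReal_ne_top hfin.ne, ?_⟩
  filter_upwards [eventually_ge_atTop 1, eventually_ge_atTop r₀] with r hr hrr₀
  have hr₀ : 0 < r := one_pos.trans_le hr
  calc ∫⁻ z in openAngle α β \ closedBall 0 (4 * r), balayageKernel S z (closedBall 0 r) ∂ν
      ≤ ∫⁻ z in openAngle α β \ closedBall 0 (4 * r), ENNReal.ofReal (8 / π * r ^ p) *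
          ENNReal.ofReal (-(1 / angleReduction α β z).im) ∂ν := by
        refine setLIntegral_mono' ((isOpen_openAngle α β).measurableSet.diff
          isClosed_closedBall.measurableSet) fun z hz => ?_
        have hzr : 4 * r < ‖z‖ := by simpa using hz.2
        rw [balayageKernel_of_mem_openAngle h hz.1]
        refine (angleMeasure_closedBall_le h.1 h.2.1 hz.1 hr₀.le hzr.le).trans ?_
        rw [ENNReal.ofReal_mul (by positivity)]
        gcongr
    _ ≤ ∫⁻ z in openAngle α β \ ball 0 r₀, ENNReal.ofReal (8 / π * r ^ p) *
          ENNReal.ofReal (-(1 / angleReduction α β z).im) ∂ν :=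
        lintegral_mono_set <| sdiff_subset_sdiff_right <|
          ball_subset_closedBall.trans (closedBall_subset_closedBall (by linarith))
    _ = ENNReal.ofReal (8 / π) * I * ENNReal.ofReal (r ^ p) := by
        rw [lintegral_const_mul' _ _ ENNReal.ofReal_ne_top, ENNReal.ofReal_mul (by positivity),
          mul_right_comm]

theorem balayageKernel_closedBall_le_rpow (hS : IsClosedRaySystem S) {q r : ℝ} {z : ℂ}
    (hr : 0 < r) (hzr : 4 * r < ‖z‖)
    (hq : ∀ α β, IsComplementaryAngle S α β → z ∈ openAngle α β → q ≤ angleExponent α β) :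
    balayageKernel S z (closedBall 0 r) ≤
      ENNReal.ofReal (8 / π) * ENNReal.ofReal ((r / ‖z‖) ^ q) := by
  by_cases hz : z ∈ S
  · have hzr' : z ∉ closedBall (0 : ℂ) r := by rw [mem_closedBall_zero_iff]; linarith
    rw [balayageKernel_of_mem hz, Measure.dirac_apply' _ isClosed_closedBall.measurableSet,
      indicator_of_notMem hzr']
    exact zero_le
  · obtain ⟨α, β, h, hzA⟩ := hS.exists_isComplementaryAngle hz
    rw [balayageKernel_of_mem_openAngle h hzA]
    exact angleMeasure_closedBall_le_rpow h.1 h.2.1 hzA hr hzr.le (hq α β h hzA)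

theorem hasGrowthAtMost_lintegral_balayageKernel_compl_wideAngles (hS : IsClosedRaySystem S)
    (hp : 0 ≤ p) (hν : HasGrowthAtMost p fun r => ν (closedBall 0 r)) :
    HasGrowthAtMost p fun r => ∫⁻ z in (closedBall 0 (4 * r) ∪ ⋃₀ wideAngles S p)ᶜ,
      balayageKernel S z (closedBall 0 r) ∂ν := by
  obtain ⟨q, hpq, hgap⟩ := exists_exponent_gap S p
  refine ((hν.lintegral_tail (hp.trans hpq.le) hpq).const_mul
    (ENNReal.ofReal_ne_top (r := 8 / π))).mono ?_
  filter_upwards [eventually_gt_atTop 0] with r hr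
  have hmeas : MeasurableSet (⋃₀ wideAngles S p) :=
    .sUnion (finite_wideAngles S p).countable fun A hA =>
      (isOpen_of_mem_complementaryAngles (wideAngles_subset S p hA)).measurableSet
  rw [← lintegral_const_mul' _ _ ENNReal.ofReal_ne_top]
  calc ∫⁻ z in (closedBall 0 (4 * r) ∪ ⋃₀ wideAngles S p)ᶜ, balayageKernel S z (closedBall 0 r) ∂ν
      ≤ ∫⁻ z in (closedBall 0 (4 * r) ∪ ⋃₀ wideAngles S p)ᶜ,
          ENNReal.ofReal (8 / π) * ENNReal.ofReal ((r / ‖z‖) ^ q) ∂ν := by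
        refine setLIntegral_mono' (isClosed_closedBall.measurableSet.union hmeas).compl
          fun z hz => ?_
        rw [compl_union] at hz
        refine balayageKernel_closedBall_le_rpow hS hr (by simpa using hz.1) fun α β h hzA =>
          hgap α β h <| not_le.1 fun hle => hz.2 ?_
        exact ⟨_, ⟨α, β, h, (angleExponent_le_iff h.1).1 hle, rfl⟩, hzA⟩
    _ ≤ ∫⁻ z in (closedBall 0 r)ᶜ,
          ENNReal.ofReal (8 / π) * ENNReal.ofReal ((r / ‖z‖) ^ q) ∂ν :=
        lintegral_mono_set <| compl_subset_compl.2 <|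
          (closedBall_subset_closedBall (by linarith)).trans subset_union_left

theorem hasGrowthAtMost_lintegral_balayageKernel (hS : IsClosedRaySystem S) (hp : 0 ≤ p)
    (hν : HasGrowthAtMost p fun r => ν (closedBall 0 r))
    (hB : ∀ α β : ℝ, IsComplementaryAngle S α β → π ≤ p * (β - α) → BlaschkeInAngle ν α β) :
    HasGrowthAtMost p fun r => ∫⁻ z, balayageKernel S z (closedBall 0 r) ∂ν := by
  have hwide := HasGrowthAtMost.setLIntegral_biUnion (finite_wideAngles S p)
    (s := fun A r => A \ closedBall 0 (4 * r))
    (φ := fun r z => balayageKernel S z (closedBall 0 r)) (ν := ν) (p := p) <| by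
      rintro _ ⟨α, β, h, hπ, rfl⟩
      exact (hB α β h hπ).hasGrowthAtMost h ((angleExponent_le_iff h.1).2 hπ)
  have hrest := hasGrowthAtMost_lintegral_balayageKernel_compl_wideAngles hS hp hν
  refine (((hν.comp_const_mul four_pos).add hwide).add hrest).mono (.of_forall fun r => ?_)
  have hcover : (univ : Set ℂ) ⊆ closedBall 0 (4 * r) ∪
      (⋃ A ∈ wideAngles S p, A \ closedBall 0 (4 * r)) ∪
      (closedBall 0 (4 * r) ∪ ⋃₀ wideAngles S p)ᶜ := by
    simp only [← iUnion_sdiff, ← sUnion_eq_biUnion, union_sdiff_self, union_compl_self,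
      subset_rfl]
  have hball : ∫⁻ z in closedBall 0 (4 * r), balayageKernel S z (closedBall 0 r) ∂ν
      ≤ ν (closedBall 0 (4 * r)) := by
    rw [← setLIntegral_one]
    exact lintegral_mono fun z =>
      have := isProbabilityMeasure_balayageKernel hS z
      prob_le_one
  rw [← setLIntegral_univ]
  refine (lintegral_mono_set hcover).trans ((lintegral_union_le _ _ _).trans ?_)
  gcongr
  exact (lintegral_union_le _ _ _).trans (by gcongr)

theorem exists_balayage (hS : IsClosedRaySystem S) (hp : 0 ≤ p) (hν : typeAtInfty p ν < ⊤)
    (hB : ∀ α β : ℝ, IsComplementaryAngle S α β → π ≤ p * (β - α) → BlaschkeInAngle ν α β) :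
    ∃ μ : Measure ℂ, IsBalayage S ν μ ∧ typeAtInfty p μ < ⊤ := by
  have hbind : ∀ B, MeasurableSet B →
      ν.bind (balayageKernel S) B = ∫⁻ z, balayageKernel S z B ∂ν := fun B hB =>
    Measure.bind_apply hB (measurable_balayageKernel hS).aemeasurable
  have hgrowth : HasGrowthAtMost p fun r => ν.bind (balayageKernel S) (closedBall 0 r) := by
    simp only [hbind _ isClosed_closedBall.measurableSet]
    exact hasGrowthAtMost_lintegral_balayageKernel hS hp (typeAtInfty_lt_top_iff.1 hν) hB
  refine ⟨ν.bind (balayageKernel S), ⟨⟨fun K hK => ?_⟩, fun B hB => ?_⟩,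
    typeAtInfty_lt_top_iff.2 hgrowth⟩
  · obtain ⟨t, ht⟩ := hK.isBounded.subset_closedBall 0
    obtain ⟨C, hC, hCr⟩ := hgrowth
    obtain ⟨r, hr, htr⟩ := (hCr.and (eventually_ge_atTop t)).exists
    exact ((measure_mono (ht.trans (closedBall_subset_closedBall htr))).trans hr).trans_lt
      (ENNReal.mul_lt_top hC.lt_top ENNReal.ofReal_lt_top)
  · simp only [hbind B hB, omega_eq_balayageKernel]

theorem IsBalayage.lintegral_omega_lt_top (h : IsBalayage S ν μ) :
    ∫⁻ z, omega S z (ball 0 1) ∂ν < ⊤ := by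
  have := h.1
  rw [← h.2 _ isOpen_ball.measurableSet]
  exact measure_ball_lt_top

end Blaschke

end Balayage

end

theorem mainTheorem7 (S : Set ℂ) (hS : Balayage.IsClosedRaySystem S)
    (p : ℝ) (hp : 0 ≤ p)
    (ν : MeasureTheory.Measure ℂ) [MeasureTheory.IsFiniteMeasureOnCompacts ν]
    (hν : Balayage.typeAtInfty p ν < ⊤) :
    ({A : Set ℂ | ∃ α β : ℝ, Balayage.IsComplementaryAngle S α β ∧
          Real.pi ≤ p * (β - α) ∧ A = Balayage.openAngle α β}.Finite ∧
      ({A : Set ℂ | ∃ α β : ℝ, Balayage.IsComplementaryAngle S α β ∧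
          Real.pi ≤ p * (β - α) ∧ A = Balayage.openAngle α β}.ncard : ℝ) ≤ 2 * p) ∧
    List.TFAE [
      ∃ r₀ : ℝ, 0 < r₀ ∧ ∫⁻ z, Balayage.omega S z (Metric.ball 0 r₀) ∂ν < ⊤,
      ∀ α β : ℝ, Balayage.IsComplementaryAngle S α β → Real.pi ≤ p * (β - α) →
        Balayage.BlaschkeInAngle ν α β,
      Balayage.BlaschkeOutside ν S,
      ∃ μ : MeasureTheory.Measure ℂ, Balayage.IsBalayage S ν μ ∧
        Balayage.typeAtInfty p μ < ⊤] := by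
  refine ⟨⟨Balayage.finite_wideAngles S p, Balayage.ncard_wideAngles_le S hp⟩, ?_⟩
  tfae_have 1 → 3 := fun ⟨r₀, hr₀, h⟩ => Balayage.blaschkeOutside_of_lintegral_omega_lt_top hr₀ h
  tfae_have 3 → 2 := fun h α β hA _ => h α β hA
  tfae_have 2 → 4 := fun h => Balayage.exists_balayage hS hp hν h
  tfae_have 4 → 1 := fun ⟨_, h, _⟩ => ⟨1, one_pos, h.lintegral_omega_lt_top⟩
  tfae_finish
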